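/- **Setting.** Let $(X,d)$ be a locally compact metric space with a countable basis of its topology. Let $\Gamma$ be a locally compact, amenable, unimodular group, with a left invariant metric $d_\Gamma$ that induces its topology and all of whose balls are precompact, and with a Haar measure $|\cdot|$. Let $\Gamma$ act continuously by isometries on $X$, and let $F'\subset X$ be a fundamental domain (each $x\in X$ lies in $\gamma F'$ for exactly one $\gamma=:\Phi(x)\in\Gamma$) which is a countable union of compact sets, has compact closure, and is such that $\Phi\colon X\to\Gamma$ is a rough isometry: there are $a\ge 1$, $b\ge 0$ with $\frac1a d_\Gamma(\Phi(x),\Phi(y))-b\le d(x,y)\le a\,d_\Gamma(\Phi(x),\Phi(y))+b$ for all $x,y\in X$. Let $\mathbb C^*$ be a compactification of $\mathbb C$ (a compact Hausdorff space containing $\mathbb C$ as a dense subspace), and let $\tilde{\mathcal D}$ be the set of pairs $\omega=(A,h)$ with $A\subset X$, $d(x,y)\ge 1$ for distinct $x,y\in A$, and $h\colon A\times A\to\mathbb C^*$, with the vague topology (identify $(A,h)$ with the measure $\sum_{x,y\in A}\delta_{(x,y,h(x,y))}$ on $X\times X\times\mathbb C^*$) and its Borel $\sigma$-algebra. Write $X(\omega):=A$.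 The group acts on $\tilde{\mathcal D}$ by $\gamma(A,h)=(\gamma A,\gamma h)$, $(\gamma h)(x,y)=h(\gamma^{-1}x,\gamma^{-1}y)$. Let $\mu$ be a $\Gamma$-invariant regular Borel probability measure on $\tilde{\mathcal D}$ (regularity is automatic if $\mathbb C^*$ is metrizable), let $\Omega$ be its topological support, and suppose that $X(\omega)\neq\emptyset$ for some $\omega\in\Omega$. Let $m(\Lambda):=\int_\Omega |\Lambda\cap X(\omega)|\,d\mu(\omega)$ (where $|\Lambda\cap X(\omega)|$ is the cardinality) for Borel $\Lambda\subset X$, and let $\mathrm{dens}(m)$ be the constant $m(IF')/|I|$, for compact $I\subset\Gamma$ with $|I|\ne0$. Call $u\colon X\to\mathbb R$ admissible if it is Borel measurable with compact support, is nonnegative or $m$-integrable (for instance bounded), and satisfies $\int_\Gamma u(\gamma^{-1}x)\,d\gamma=1$ for all $x\in X$. Let $\mathcal H=\int_\Omega^\oplus \ell^2(X(\omega))\,d\mu(\omega)$, and let $H$ satisfy (A) $H\colon\mathcal H\to\mathcal H$ is a selfadjoint operator $H=\int_\Omega^\oplus H_\omega\,d\mu(\omega)$ with bounded operators $H_\omega$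 on $\ell^2(X(\omega))$ whose norms are bounded by one constant for all $\omega\in\Omega$ and whose matrix is $H_\omega(x,y)=h(x,y)$ for $\omega=(A,h)\in\Omega$; it has finite hopping range (there is $R<\infty$ such that $H_\omega(x,y)=0$ whenever $\omega\in\Omega$, $x,y\in X(\omega)$, $d(x,y)\ge R$); and it is equivariant with respect to a given family of functions $s_\gamma\colon X\to\{z\in\mathbb C:|z|=1\}$, $\gamma\in\Gamma$, that is, $s_\gamma(x)H_{\gamma\omega}(\gamma x,\gamma y)\overline{s_\gamma(y)}=H_\omega(x,y)$ for all $\gamma\in\Gamma$, $\omega\in\Omega$, $x,y\in X(\omega)$. **Theorem.** The density is well defined: $0<\mathrm{dens}(m)<\infty$ and $m(IF')=\mathrm{dens}(m)\,|I|$ for all compact $I\subset\Gamma$. There is a locally finite Borel measure $\nu_H$ on $\mathbb R$ such that the following hold. 1. For every admissible $u$ and every $\varphi\in C_c(\mathbb R)$, the function $\omega\mapsto\mathrm{Tr}(u\,\varphi(H_\omega))=\sum_{x\in X(\omega)}u(x)\,\varphi(H_\omega)(x,x)$ is $\mu$-integrable and $$\nu_H(\varphi)=\frac1{\mathrm{dens}(m)}\int_\Omega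 \mathrm{Tr}(u\,\varphi(H_\omega))\,d\mu(\omega);$$ and, for each admissible $u$, $\nu_H$ is the only locally finite Borel measure on $\mathbb R$ that satisfies this for all $\varphi\in C_c(\mathbb R)$. In particular $\nu_H$ does not depend on $u$. 2. $\nu_H$ is a spectral measure for $H$: if $E_H$ denotes the spectral family of $H$, then for every Borel set $B\subset\mathbb R$ one has $\nu_H(B)=0$ if and only if $E_H(B)=0$. 3. $\nu_H((-\infty,\lambda])<\infty$ for all $\lambda\in\mathbb R$, so that $N_H(\lambda):=\nu_H((-\infty,\lambda])$ defines a function $N_H\colon\mathbb R\to\mathbb R$, the integrated density of states. -/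

import Mathlib

open MeasureTheory Set Filter Topology
open scoped ENNReal Pointwise BoundedContinuousFunction ComplexConjugate CompactlySupported

noncomputable section

namespace IDS

/-! ### The group and the geometry -/

/-- Amenability of a topological group: there is a left invariant mean on the bounded continuous
real functions. -/
def IsAmenable (Γ : Type*) [Group Γ] [TopologicalSpace Γ] [IsTopologicalGroup Γ] : Prop :=
  ∃ M : (Γ →ᵇ ℝ) →ₗ[ℝ] ℝ, (∀ f : Γ →ᵇ ℝ, 0 ≤ f → 0 ≤ M f) ∧ M 1 = 1 ∧
    ∀ (γ : Γ) (f : Γ →ᵇ ℝ), M (f.compContinuous ⟨fun x => γ * x, continuous_const_mul γ⟩) = M f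

/-- `F'` is a fundamental domain: its translates `γ F'` are pairwise disjoint and cover `X`.
It is a countable union of compact sets and has compact closure, and the map
`Φ : X → Γ`, `Φ x = γ` for `x ∈ γ F'`, is a rough isometry. -/
structure IsRoughFundamentalDomain (Γ : Type*) {X : Type*} [MetricSpace X] [Group Γ]
    [MetricSpace Γ] [MulAction Γ X] (F' : Set X) : Prop where
  existsUnique_mem : ∀ x : X, ∃! γ : Γ, x ∈ γ • F'
  isCompact_closure : IsCompact (closure F')
  isSigmaCompact : IsSigmaCompact F'
  roughIsometry : ∃ a b : ℝ, 1 ≤ a ∧ 0 ≤ b ∧ ∀ (x y : X) (γ δ : Γ), x ∈ γ • F' → y ∈ δ • F' →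
    a⁻¹ * dist γ δ - b ≤ dist x y ∧ dist x y ≤ a * dist γ δ + b

/-! ### The configuration space -/

/-- A pair `(A, h)` of a uniformly discrete set `A ⊆ X` (distinct points have distance at
least one) and a function `h : A × A → K`. -/
structure Config (X : Type*) [MetricSpace X] (K : Type*) where
  carrier : Set X
  one_le_dist : ∀ x ∈ carrier, ∀ y ∈ carrier, x ≠ y → 1 ≤ dist x y
  h : carrier → carrier → K

section Config

variable {X K Γ : Type*} [MetricSpace X]

/-- The vague topology: `(A, h)` is identified with the point measure
`∑_{x, y ∈ A} δ_{(x, y, h(x,y))}` on `X × X × K`. It is the coarsest topology for which the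
integrals of all compactly supported continuous functions are continuous. (The sums are finite,
since a compact set contains only finitely many points of `A`.) -/
instance [TopologicalSpace K] : TopologicalSpace (Config X K) :=
  ⨅ φ : C_c(X × X × K, ℂ), TopologicalSpace.induced
    (fun ω : Config X K =>
      ∑ᶠ p : ω.carrier × ω.carrier, φ ((p.1 : X), (p.2 : X), ω.h p.1 p.2))
    inferInstance

instance [TopologicalSpace K] : MeasurableSpace (Config X K) := borel _

instance [TopologicalSpace K] : BorelSpace (Config X K) := ⟨rfl⟩

/-- The action `γ (A, h) = (γ A, γ h)` with `(γ h)(x, y) = h (γ⁻¹ x, γ⁻¹ y)`; here `γ A` is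
written as `{x | γ⁻¹ x ∈ A}`. -/
instance [Group Γ] [MulAction Γ X] [IsIsometricSMul Γ X] : SMul Γ (Config X K) where
  smul γ ω :=
    { carrier := {x | γ⁻¹ • x ∈ ω.carrier}
      one_le_dist := fun x hx y hy hxy => by
        have := ω.one_le_dist _ hx _ hy (fun h => hxy (smul_left_cancel _ h))
        rwa [dist_smul] at this
      h := fun x y => ω.h ⟨γ⁻¹ • (x : X), x.2⟩ ⟨γ⁻¹ • (y : X), y.2⟩ }

/-- The point `γ x` of `X(γ ω)`, for a point `x` of `X(ω)`. -/
def Config.smulPoint [Group Γ] [MulAction Γ X] [IsIsometricSMul Γ X] (γ : Γ) (ω : Config X K)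
    (x : ω.carrier) : (γ • ω).carrier :=
  ⟨γ • (x : X), by
    change γ⁻¹ • γ • (x : X) ∈ ω.carrier
    rw [inv_smul_smul]
    exact x.2⟩

/-- The counting measure `δ_{X(ω)} = ∑_{x ∈ X(ω)} δ_x` on `X`. -/
def Config.pointMeasure [MeasurableSpace X] (ω : Config X K) : Measure X :=
  Measure.sum fun x : ω.carrier => Measure.dirac (x : X)

/-- The Hilbert space `ℓ²(X(ω))`. -/
abbrev Config.ell2 (ω : Config X K) : Type _ := lp (fun _ : ω.carrier => ℂ) 2

/-- The matrix element `T(x, y) = (T δ_y)(x)` of an operator on `ℓ²(X(ω))`. -/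
def Config.entry (ω : Config X K) (T : ω.ell2 →L[ℂ] ω.ell2) (x y : ω.carrier) : ℂ :=
  open scoped Classical in
  (T (lp.single 2 y (1 : ℂ)) : ω.carrier → ℂ) x

/-- `Tr (u T)`, for an operator `T` on `ℓ²(X(ω))` and the operator of multiplication by `u`:
the sum of the diagonal elements `u(x) T(x, x)`. (A finite sum if `u` has compact support.) -/
def Config.trace (ω : Config X K) (u : X → ℝ) (T : ω.ell2 →L[ℂ] ω.ell2) : ℂ :=
  ∑' x : ω.carrier, (u x : ℂ) * ω.entry T x x

end Config

/-! ### The measures induced by `μ` -/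

section Measures

variable {X K Γ : Type*} [MetricSpace X] [MeasurableSpace X] [TopologicalSpace K]

/-- The measure `m(Λ) = ∫ |Λ ∩ X(ω)| dμ(ω)` on `X`. -/
def intensity (μ : Measure (Config X K)) : Measure X :=
  μ.bind fun ω => ω.pointMeasure

/-- The measure `∫ δ_ω ⊗ δ_{X(ω)} dμ(ω)` on pairs `(ω, x)`. -/
def fiberMeasure (μ : Measure (Config X K)) : Measure (Config X K × X) :=
  μ.bind fun ω => ω.pointMeasure.map (Prod.mk ω)

/-- The direct integral Hilbert space `∫^⊕ ℓ²(X(ω)) dμ(ω)`, realized as the space of (classes of)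
square integrable measurable functions of pairs `(ω, x)` with `x ∈ X(ω)`. -/
abbrev DirectIntegral (μ : Measure (Config X K)) : Type _ := Lp ℂ 2 (fiberMeasure μ)

/-- The density `dens(m) = m(I F') / |I|`. The quotient is the same for all compact `I` with
`|I| ≠ 0`; here `I` is the closed unit ball of the group. -/
def dens [Group Γ] [MetricSpace Γ] [MeasurableSpace Γ] [MulAction Γ X]
    (vol : Measure Γ) (F' : Set X) (μ : Measure (Config X K)) : ℝ≥0∞ :=
  intensity μ (Metric.closedBall (1 : Γ) 1 • F') / vol (Metric.closedBall (1 : Γ) 1)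

/-- Admissible weights: `u` is a (Borel measurable) function with compact support and
`∫ u (γ⁻¹ x) dγ = 1` for all `x`. The last condition makes the integral of `∑_{x ∈ X(ω)} u(x)`
meaningful; it holds if `u` is nonnegative, and also if `u` is bounded. -/
structure IsAdmissible [Group Γ] [MeasurableSpace Γ] [MulAction Γ X]
    (vol : Measure Γ) (μ : Measure (Config X K)) (u : X → ℝ) : Prop where
  measurable : Measurable u
  hasCompactSupport : HasCompactSupport u
  integral_eq_one : ∀ x : X, ∫ γ : Γ, u (γ⁻¹ • x) ∂vol = 1
  nonneg_or_integrable : (∀ x, 0 ≤ u x) ∨ Integrable u (intensity μ)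

end Measures

/-! ### Operators -/

section Operators

variable {X K Γ : Type*} [MetricSpace X] [MeasurableSpace X] [TopologicalSpace K]

/-- Condition (A), with `Ω` the topological support of `μ`: `H` is a bounded, selfadjoint,
decomposable, equivariant operator of finite hopping range on `∫^⊕ ℓ²(X(ω)) dμ(ω)`, with fibers
`Hf ω`. The embedding `ι` is that of `ℂ` into its compactification `K`. -/
structure ConditionA [Group Γ] [MulAction Γ X] [IsIsometricSMul Γ X] (ι : ℂ → K)
    (μ : Measure (Config X K)) (s : Γ → X → Circle)
    (Hf : ∀ ω : Config X K, ω.ell2 →L[ℂ] ω.ell2)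
    (H : DirectIntegral μ →L[ℂ] DirectIntegral μ) : Prop where
  /-- For `ω = (A, h)` in `Ω` the matrix of the fiber is `h`. -/
  entry_eq : ∀ ω ∈ μ.support, ∀ x y : ω.carrier, ι (ω.entry (Hf ω) x y) = ω.h x y
  /-- The fibers are uniformly bounded. -/
  bounded : ∃ C : ℝ, ∀ ω ∈ μ.support, ‖Hf ω‖ ≤ C
  /-- `H` is the direct integral of its fibers, `(H f)_ω = H_ω f_ω`. -/
  decomposable : ∀ f : DirectIntegral μ, ∀ᵐ ω ∂μ, ∃ v : ω.ell2,
    (∀ x : ω.carrier, v x = f (ω, (x : X))) ∧ ∀ x : ω.carrier, H f (ω, (x : X)) = Hf ω v x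
  selfAdjoint : IsSelfAdjoint H
  finiteRange : ∃ R : ℝ, ∀ ω ∈ μ.support, ∀ x y : ω.carrier,
    R ≤ dist (x : X) (y : X) → ω.entry (Hf ω) x y = 0
  equivariant : ∀ (γ : Γ), ∀ ω ∈ μ.support, ∀ x y : ω.carrier,
    (s γ x : ℂ) * (γ • ω).entry (Hf (γ • ω)) (ω.smulPoint γ x) (ω.smulPoint γ y) *
      conj (s γ y : ℂ) = ω.entry (Hf ω) x y

/-- `E` is the spectral family of the bounded selfadjoint operator `T`: a projection valued
measure on the Borel sets of `ℝ` with `T = ∫ t dE(t)`. -/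
structure IsSpectralFamily {V : Type*} [NormedAddCommGroup V] [InnerProductSpace ℂ V]
    [CompleteSpace V] (T : V →L[ℂ] V) (E : Set ℝ → V →L[ℂ] V) : Prop where
  isStarProjection : ∀ B, MeasurableSet B → IsStarProjection (E B)
  univ : E Set.univ = 1
  hasSum : ∀ B : ℕ → Set ℝ, (∀ i, MeasurableSet (B i)) → Pairwise (Function.onFun Disjoint B) →
    ∀ v, HasSum (fun i => E (B i) v) (E (⋃ i, B i) v)
  resolution : ∀ v, ∃ ρ : Measure ℝ, IsFiniteMeasure ρ ∧
    (∀ B, MeasurableSet B → inner ℂ v (E B v) = (ρ.real B : ℂ)) ∧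
    Integrable (fun t : ℝ => t) ρ ∧ inner ℂ v (T v) = ((∫ t, t ∂ρ : ℝ) : ℂ)

/-- The function `ω ↦ Tr (u φ(H_ω))`, with `φ(H_ω)` given by the continuous functional calculus
(on selfadjoint operators, whose spectrum is real). -/
def traceFun (Hf : ∀ ω : Config X K, ω.ell2 →L[ℂ] ω.ell2) (u : X → ℝ) (φ : C_c(ℝ, ℂ))
    (ω : Config X K) : ℂ :=
  ω.trace u (cfc (fun z : ℂ => φ z.re) (Hf ω))

/-- The identity `ν(φ) = dens(m)⁻¹ ∫ Tr (u φ(H_ω)) dμ(ω)` for all `φ ∈ C_c(ℝ)`. -/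
def TraceFormula [Group Γ] [MetricSpace Γ] [MeasurableSpace Γ] [MulAction Γ X]
    (vol : Measure Γ) (F' : Set X) (μ : Measure (Config X K))
    (Hf : ∀ ω : Config X K, ω.ell2 →L[ℂ] ω.ell2) (u : X → ℝ) (ν : Measure ℝ) : Prop :=
  ∀ φ : C_c(ℝ, ℂ), ∫ t, φ t ∂ν =
    ((dens vol F' μ).toReal : ℂ)⁻¹ * ∫ ω in μ.support, traceFun Hf u φ ω ∂μ

/-- The distribution function `N(t) = ν((-∞, t])`, the integrated density of states if `ν = ν_H`. -/
def distributionFunction (ν : Measure ℝ) (t : ℝ) : ℝ := ν.real (Set.Iic t)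

end Operators

end IDS

end

open MeasureTheory Set Filter Topology
open scoped ENNReal Pointwise BoundedContinuousFunction ComplexConjugate CompactlySupported

noncomputable section

set_option linter.unusedSectionVars false

namespace IDS

/-! ### Spectral measures of representations of `C(S, ℂ)` -/

section Representation

variable {S V : Type*} [TopologicalSpace S] [CompactSpace S] [T2Space S] [MeasurableSpace S]
  [BorelSpace S] [NormedAddCommGroup V] [InnerProductSpace ℂ V] [CompleteSpace V]

/-! Everything is read off from one measure M, the `fiberMeasure` on pairs (ω, x) with x ∈ X(ω), and
from the diagonal D(ω, x) = φ(H_ω)(x, x). Invariance of μ makes M invariant under the diagonal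
action of Γ, and with it the image m of M on X, the intensity. The image of m under Φ is a left
invariant measure on Γ, finite on compact sets, hence a multiple of Haar measure; the factor is the
density. It is finite because a set in which all distances are below one contains at most one point
of each configuration, and positive because all configurations close to a nonempty one in the
support are nonempty.

The functional calculus acts fiberwise (`Decomposes.cfc`), so D is measurable and bounded.
Equivariance makes D invariant almost everywhere, since the phases cancel on the diagonal
(`ConditionA.ae_pairSMul`). Hence ∫ Tr(u φ(H_ω)) dμ = ∫ u D dM, and Fubini over Γ times the space of
pairs gives the same value for all weights of integral one along the orbits
(`integral_eq_of_average`); unimodularity allows γ to be exchanged with γ⁻¹. The convenient weight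
is the normalized indicator function of Λ = B F', with B the closed unit ball of Γ.

To recognize a spectral measure, X is cut into countably many Borel pieces Q_i, each with at most
one point of every configuration. For S = {(ω, x) : x ∈ Λ ∩ Q_i} the vector 1_S has a basis vector
or zero in almost every fiber, so ⟨1_S, φ(H) 1_S⟩ = ∫_S D dM (`inner_indVec_cfc`). Thus ν_H is, up
to a constant, the sum over i of the scalar spectral measures of these vectors, with total mass
proportional to m(Λ) < ∞.

If ν_H(J) = 0, then E(J) kills these vectors, and also 1_S for every smaller measurable S, because
∫_S D dM is additive in S (`apply_indVec_eq_zero`). By selfadjointness E(J) f vanishes over Λ for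
all f, and by invariance also over countably many translates of Λ that cover X, so E(J) = 0. The
converse is immediate. The spectral family is itself constructed, from the Riesz representation of v
↦ ⟨v, φ(H) v⟩. -/

lemma inner_map_star_mul_self (π : C(S, ℂ) →⋆ₐ[ℂ] (V →L[ℂ] V)) (g : C(S, ℂ)) (v : V) :
    inner ℂ v (π (star g * g) v) = ((‖π g v‖ ^ 2 : ℝ) : ℂ) := by
  rw [map_mul, map_star, ContinuousLinearMap.star_eq_adjoint, mul_apply_eq_comp,
    ContinuousLinearMap.adjoint_inner_right, inner_self_eq_norm_sq_to_K]
  norm_cast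

/-- A real continuous function on `S`, viewed as a complex one. -/
def complexify (f : C(S, ℝ)) : C(S, ℂ) := ⟨fun x => (f x : ℂ), by fun_prop⟩

/-- A nonnegative f is the square of √f, so ⟨v, π(f) v⟩ = ‖π(√f) v‖² ≥ 0 and the Riesz–Markov
theorem applies to real functions. Complex functions follow by splitting into real and imaginary
parts, as π(f) is selfadjoint for real f. -/
lemma exists_scalarMeasure (π : C(S, ℂ) →⋆ₐ[ℂ] (V →L[ℂ] V)) (v : V) :
    ∃ ρ : Measure S, IsFiniteMeasure ρ ∧ ρ.Regular ∧
      ∀ g : C(S, ℂ), ∫ x, g x ∂ρ = inner ℂ v (π g v) := by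
  have hpos : ∀ f : C(S, ℝ), 0 ≤ f → 0 ≤ (inner ℂ v (π (complexify f) v)).re := by
    intro f hf
    let g : C(S, ℂ) := ⟨fun x => (√(f x) : ℂ), by fun_prop⟩
    have hg : star g * g = complexify f := by
      ext x
      have := Real.mul_self_sqrt (hf x)
      simp only [ContinuousMap.mul_apply, ContinuousMap.star_apply, g, ContinuousMap.coe_mk,
        complexify, Complex.star_def, Complex.conj_ofReal]
      exact_mod_cast this
    rw [← hg, inner_map_star_mul_self, Complex.ofReal_re]
    positivity
  let L₀ : C_c(S, ℝ) →ₗ[ℝ] ℝ :=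
    { toFun := fun f => (inner ℂ v (π (complexify f) v)).re
      map_add' := fun f g => by
        have : complexify (f + g : C_c(S, ℝ)).toContinuousMap
            = complexify f.toContinuousMap + complexify g.toContinuousMap := by
          ext x; simp [complexify]
        rw [← Complex.add_re, ← inner_add_right, ← _root_.add_apply, ← map_add]
        exact congrArg (fun h => (inner ℂ v (π h v)).re) this
      map_smul' := fun c f => by
        have : complexify (c • f : C_c(S, ℝ)).toContinuousMap
            = (c : ℂ) • complexify f.toContinuousMap := by
          ext x; simp [complexify]
        have h2 : (inner ℂ v (π ((c : ℂ) • complexify f.toContinuousMap) v)).re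
            = c * (inner ℂ v (π (complexify f.toContinuousMap) v)).re := by
          rw [map_smul, _root_.smul_apply, inner_smul_right, Complex.re_ofReal_mul]
        exact (congrArg (fun h => (inner ℂ v (π h v)).re) this).trans h2 }
  let L : C_c(S, ℝ) →ₚ[ℝ] ℝ := PositiveLinearMap.mk₀ L₀ fun f hf => hpos _ hf
  have hreal : ∀ f : C(S, ℝ), ∫ x, (f x : ℂ) ∂(RealRMK.rieszMeasure L)
      = inner ℂ v (π (complexify f) v) := by
    intro f
    let f' : C_c(S, ℝ) := ⟨f, HasCompactSupport.of_compactSpace _⟩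
    have h1 := RealRMK.integral_rieszMeasure L f'
    have h2 : IsSelfAdjoint (π (complexify f)) := by
      rw [IsSelfAdjoint, ← map_star]
      congr 1
      ext x
      simp [complexify]
    rw [integral_complex_ofReal]
    refine (congrArg _ h1).trans ?_
    exact h2.isSymmetric.coe_re_inner_self_apply v
  refine ⟨RealRMK.rieszMeasure L, inferInstance, inferInstance, fun g => ?_⟩
  let gr : C(S, ℝ) := ⟨fun x => (g x).re, by fun_prop⟩
  let gi : C(S, ℝ) := ⟨fun x => (g x).im, by fun_prop⟩
  have hg : g = complexify gr + Complex.I • complexify gi := by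
    ext x
    simp [complexify, gr, gi, mul_comm Complex.I, Complex.re_add_im]
  have hint : ∀ f : C(S, ℂ), Integrable f (RealRMK.rieszMeasure L) := fun f =>
    f.continuous.integrable_of_hasCompactSupport (HasCompactSupport.of_compactSpace _)
  rw [hg]
  refine (integral_add (hint _) ((hint _).smul _)).trans ?_
  simp only [Pi.smul_apply]
  rw [integral_smul, map_add, map_smul]
  simp only [_root_.add_apply, _root_.smul_apply, inner_add_right,
    inner_smul_right, smul_eq_mul]
  rw [← hreal gr, ← hreal gi]
  rfl

/-- The scalar spectral measure of a vector `v`. -/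
def scalarMeasure (π : C(S, ℂ) →⋆ₐ[ℂ] (V →L[ℂ] V)) (v : V) : Measure S :=
  (exists_scalarMeasure π v).choose

instance (π : C(S, ℂ) →⋆ₐ[ℂ] (V →L[ℂ] V)) (v : V) : IsFiniteMeasure (scalarMeasure π v) :=
  (exists_scalarMeasure π v).choose_spec.1

instance (π : C(S, ℂ) →⋆ₐ[ℂ] (V →L[ℂ] V)) (v : V) : (scalarMeasure π v).Regular :=
  (exists_scalarMeasure π v).choose_spec.2.1

lemma integral_scalarMeasure (π : C(S, ℂ) →⋆ₐ[ℂ] (V →L[ℂ] V)) (v : V) (g : C(S, ℂ)) :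
    ∫ x, g x ∂scalarMeasure π v = inner ℂ v (π g v) :=
  (exists_scalarMeasure π v).choose_spec.2.2 g

/-- The embedding of continuous functions into `L²`. -/
def toL2 (ρ : Measure S) [IsFiniteMeasure ρ] : C(S, ℂ) →ₗ[ℂ] Lp ℂ 2 ρ :=
  (ContinuousMap.toLp 2 ρ ℂ : C(S, ℂ) →L[ℂ] Lp ℂ 2 ρ).toLinearMap

lemma denseRange_toL2 (ρ : Measure S) [IsFiniteMeasure ρ] [ρ.Regular] :
    DenseRange (toL2 ρ) :=
  ContinuousMap.toLp_denseRange ℂ ρ ℂ (by norm_num)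

/-- The evaluation of a representation at a vector. -/
def evalAt (π : C(S, ℂ) →⋆ₐ[ℂ] (V →L[ℂ] V)) (v : V) : C(S, ℂ) →ₗ[ℂ] V where
  toFun g := π g v
  map_add' g h := by simp
  map_smul' c g := by simp

/-- ‖π(g) v‖² = ⟨v, π(ḡ g) v⟩ is the integral of |g|². This isometry is what allows g to be replaced
by square integrable functions, in particular by indicator functions. -/
lemma norm_evalAt (π : C(S, ℂ) →⋆ₐ[ℂ] (V →L[ℂ] V)) (v : V) (ρ : Measure S) [IsFiniteMeasure ρ]
    (hρ : scalarMeasure π v = ρ) (g : C(S, ℂ)) : ‖evalAt π v g‖ = ‖toL2 ρ g‖ := by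
  subst hρ
  have h1 := inner_map_star_mul_self π g v
  rw [← integral_scalarMeasure] at h1
  have h2 : inner ℂ (toL2 (scalarMeasure π v) g) (toL2 (scalarMeasure π v) g)
      = ((‖π g v‖ ^ 2 : ℝ) : ℂ) := by
    rw [← h1]
    refine (ContinuousMap.inner_toLp (𝕜 := ℂ) (scalarMeasure π v) g g).trans ?_
    refine integral_congr_ae (.of_forall fun x => ?_)
    simp [mul_comm]
  rw [inner_self_eq_norm_sq_to_K] at h2
  have h3 : ‖toL2 (scalarMeasure π v) g‖ ^ 2 = ‖π g v‖ ^ 2 := by exact Complex.ofReal_injective (by push_cast at h2 ⊢; exact h2)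
  exact ((pow_left_inj₀ (norm_nonneg _) (norm_nonneg _) two_ne_zero).1 h3).symm

/-- The extension of `g ↦ π g v` to square integrable functions. -/
def extendAt (π : C(S, ℂ) →⋆ₐ[ℂ] (V →L[ℂ] V)) (v : V) :
    Lp ℂ 2 (scalarMeasure π v) →L[ℂ] V :=
  (evalAt π v).extendOfNorm (toL2 (scalarMeasure π v))

lemma extendAt_toL2 (π : C(S, ℂ) →⋆ₐ[ℂ] (V →L[ℂ] V)) (v : V) (g : C(S, ℂ)) :
    extendAt π v (toL2 _ g) = π g v :=
  LinearMap.extendOfNorm_eq (denseRange_toL2 _)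
    ⟨1, fun g => by rw [one_mul, norm_evalAt π v _ rfl]⟩ g

lemma norm_extendAt (π : C(S, ℂ) →⋆ₐ[ℂ] (V →L[ℂ] V)) (v : V)
    (f : Lp ℂ 2 (scalarMeasure π v)) : ‖extendAt π v f‖ = ‖f‖ := by
  refine (denseRange_toL2 (scalarMeasure π v)).induction_on f
    (isClosed_eq (by fun_prop) (by fun_prop)) fun g => ?_
  rw [extendAt_toL2, ← norm_evalAt π v _ rfl]
  rfl

lemma inner_extendAt (π : C(S, ℂ) →⋆ₐ[ℂ] (V →L[ℂ] V)) (v : V)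
    (f : Lp ℂ 2 (scalarMeasure π v)) :
    inner ℂ v (extendAt π v f) = inner ℂ (toL2 (scalarMeasure π v) 1) f := by
  refine (denseRange_toL2 (scalarMeasure π v)).induction_on f
    (isClosed_eq (by fun_prop) (by fun_prop)) fun g => ?_
  rw [extendAt_toL2, ← integral_scalarMeasure]
  refine Eq.trans ?_ (ContinuousMap.inner_toLp (𝕜 := ℂ) (scalarMeasure π v) 1 g).symm
  refine integral_congr_ae (.of_forall fun x => ?_)
  simp

/-- The value of the spectral projection at v is defined in an L² space that depends on v. Several
vectors are compared through a common dominating measure ρ: one continuous g close to the indicator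
in L²(ρ) serves all of them. -/
lemma extendAt_indicator_of_approx (π : C(S, ℂ) →⋆ₐ[ℂ] (V →L[ℂ] V)) (v : V) (ρ : Measure S)
    [IsFiniteMeasure ρ] (h : scalarMeasure π v ≤ ρ) {B : Set S} (hB : MeasurableSet B)
    (g : C(S, ℂ)) :
    ‖extendAt π v (indicatorConstLp 2 hB (measure_ne_top _ _) 1) - π g v‖ ≤
      ‖indicatorConstLp 2 hB (measure_ne_top ρ _) (1 : ℂ) - toL2 ρ g‖ := by
  rw [← extendAt_toL2, ← map_sub, norm_extendAt, Lp.norm_def, Lp.norm_def]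
  refine ENNReal.toReal_mono (Lp.eLpNorm_ne_top _) ?_
  refine le_trans (le_of_eq (eLpNorm_congr_ae ?_)) (eLpNorm_mono_measure _ h)
  have e1 := (Lp.coeFn_sub (indicatorConstLp 2 hB (measure_ne_top ρ _) (1 : ℂ)) (toL2 ρ g)).trans
    (indicatorConstLp_coeFn.sub (ContinuousMap.coeFn_toLp (𝕜 := ℂ) (p := 2) ρ g))
  have e2 := (Lp.coeFn_sub (indicatorConstLp 2 hB (measure_ne_top (scalarMeasure π v) _) (1 : ℂ))
    (toL2 (scalarMeasure π v) g)).trans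
    (indicatorConstLp_coeFn.sub
      (ContinuousMap.coeFn_toLp (𝕜 := ℂ) (p := 2) (scalarMeasure π v) g))
  exact e2.trans ((Measure.absolutelyContinuous_of_le h).ae_eq e1).symm

/-- The spectral projection of a Borel set, as a linear map. -/
def projectionLinear (π : C(S, ℂ) →⋆ₐ[ℂ] (V →L[ℂ] V)) {B : Set S} (hB : MeasurableSet B) :
    V →ₗ[ℂ] V where
  toFun v := extendAt π v (indicatorConstLp 2 hB (measure_ne_top _ _) 1)
  map_add' v w := by
    -- One measure that dominates the three scalar measures; additivity of `π g` then passes to the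
    -- limit, with an error of at most ε / 3 from each vector.
    let ρ := scalarMeasure π v + scalarMeasure π w + scalarMeasure π (v + w)
    refine eq_of_forall_dist_le fun ε hε => ?_
    obtain ⟨g, hg⟩ := (denseRange_toL2 ρ).exists_dist_lt
      (indicatorConstLp 2 hB (measure_ne_top ρ _) (1 : ℂ)) (show 0 < ε / 3 by positivity)
    rw [dist_eq_norm] at hg
    have h1 := extendAt_indicator_of_approx π v ρ
      (Measure.le_add_right (Measure.le_add_right le_rfl)) hB g
    have h2 := extendAt_indicator_of_approx π w ρ
      (Measure.le_add_right (Measure.le_add_left le_rfl)) hB g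
    have h3 := extendAt_indicator_of_approx π (v + w) ρ (Measure.le_add_left le_rfl) hB g
    rw [dist_eq_norm]
    set a := extendAt π v (indicatorConstLp 2 hB (measure_ne_top _ _) 1)
    set b := extendAt π w (indicatorConstLp 2 hB (measure_ne_top _ _) 1)
    set c := extendAt π (v + w) (indicatorConstLp 2 hB (measure_ne_top _ _) 1)
    have e : c - (a + b) = (c - π g (v + w)) - (a - π g v) - (b - π g w) := by
      rw [map_add]; abel
    rw [e]
    linarith [norm_sub_le ((c - π g (v + w)) - (a - π g v)) (b - π g w),
      norm_sub_le (c - π g (v + w)) (a - π g v)]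
  map_smul' k v := by
    let ρ := scalarMeasure π v + scalarMeasure π (k • v)
    refine eq_of_forall_dist_le fun ε hε => ?_
    have hk : 0 < 1 + ‖k‖ := by positivity
    obtain ⟨g, hg⟩ := (denseRange_toL2 ρ).exists_dist_lt
      (indicatorConstLp 2 hB (measure_ne_top ρ _) (1 : ℂ)) (show 0 < ε / (1 + ‖k‖) by positivity)
    rw [dist_eq_norm, lt_div_iff₀ hk] at hg
    have h1 := extendAt_indicator_of_approx π v ρ (Measure.le_add_right le_rfl) hB g
    have h2 := extendAt_indicator_of_approx π (k • v) ρ (Measure.le_add_left le_rfl) hB g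
    rw [dist_eq_norm]
    simp only [RingHom.id_apply]
    set a := extendAt π v (indicatorConstLp 2 hB (measure_ne_top _ _) 1)
    set c := extendAt π (k • v) (indicatorConstLp 2 hB (measure_ne_top _ _) 1)
    have e : c - k • a = (c - π g (k • v)) - k • (a - π g v) := by
      rw [map_smul, smul_sub]; abel
    rw [e]
    have h4 := norm_sub_le (c - π g (k • v)) (k • (a - π g v))
    rw [norm_smul] at h4
    nlinarith [norm_nonneg k, mul_le_mul_of_nonneg_left h1 (norm_nonneg k)]

lemma inner_projectionLinear (π : C(S, ℂ) →⋆ₐ[ℂ] (V →L[ℂ] V)) {B : Set S}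
    (hB : MeasurableSet B) (v : V) :
    inner ℂ v (projectionLinear π hB v) = (((scalarMeasure π v).real B : ℝ) : ℂ) := by
  change inner ℂ v (extendAt π v _) = _
  rw [inner_extendAt, ← inner_conj_symm, L2.inner_indicatorConstLp_one]
  have : ∫ x in B, (toL2 (scalarMeasure π v) 1 : S → ℂ) x ∂scalarMeasure π v
      = ∫ x in B, (1 : ℂ) ∂scalarMeasure π v := by
    refine integral_congr_ae (ae_restrict_of_ae ?_)
    filter_upwards [ContinuousMap.coeFn_toLp (𝕜 := ℂ) (p := 2) (scalarMeasure π v) (1 : C(S, ℂ))]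
      with x hx
    exact hx
  rw [this]
  simp

lemma norm_projectionLinear_sq (π : C(S, ℂ) →⋆ₐ[ℂ] (V →L[ℂ] V)) {B : Set S}
    (hB : MeasurableSet B) (v : V) :
    ‖projectionLinear π hB v‖ ^ 2 = (scalarMeasure π v).real B := by
  change ‖extendAt π v _‖ ^ 2 = _
  rw [norm_extendAt, norm_indicatorConstLp (by norm_num) (by norm_num)]
  simp only [norm_one, one_mul, ENNReal.toReal_ofNat]
  rw [← Real.sqrt_eq_rpow, Real.sq_sqrt measureReal_nonneg]

lemma scalarMeasure_univ (π : C(S, ℂ) →⋆ₐ[ℂ] (V →L[ℂ] V)) (v : V) :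
    (scalarMeasure π v).real univ = ‖v‖ ^ 2 := by
  have h := integral_scalarMeasure π v 1
  simp only [ContinuousMap.one_apply, integral_const, map_one, one_apply_eq_self,
    inner_self_eq_norm_sq_to_K] at h
  rw [Complex.real_smul, mul_one] at h
  exact Complex.ofReal_injective (by push_cast at h ⊢; exact h)

/-- The spectral projection of a Borel set. -/
def spectralProjection (π : C(S, ℂ) →⋆ₐ[ℂ] (V →L[ℂ] V)) {B : Set S} (hB : MeasurableSet B) :
    V →L[ℂ] V :=
  (projectionLinear π hB).mkContinuous 1 fun v => by
    rw [one_mul, ← pow_le_pow_iff_left₀ (norm_nonneg _) (norm_nonneg _) two_ne_zero,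
      norm_projectionLinear_sq, ← scalarMeasure_univ π v]
    exact measureReal_mono (subset_univ _)

lemma spectralProjection_apply (π : C(S, ℂ) →⋆ₐ[ℂ] (V →L[ℂ] V)) {B : Set S}
    (hB : MeasurableSet B) (v : V) :
    spectralProjection π hB v = extendAt π v (indicatorConstLp 2 hB (measure_ne_top _ _) 1) :=
  rfl

lemma inner_spectralProjection (π : C(S, ℂ) →⋆ₐ[ℂ] (V →L[ℂ] V)) {B : Set S}
    (hB : MeasurableSet B) (v : V) :
    inner ℂ v (spectralProjection π hB v) = (((scalarMeasure π v).real B : ℝ) : ℂ) :=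
  inner_projectionLinear π hB v

/-- The quadratic form of P is real, so P is selfadjoint. Then ⟨P² v, v⟩ = ‖P v‖² is the scalar
measure of B, as is ⟨P v, v⟩, and over ℂ the quadratic form determines the operator. -/
lemma isStarProjection_spectralProjection (π : C(S, ℂ) →⋆ₐ[ℂ] (V →L[ℂ] V)) {B : Set S}
    (hB : MeasurableSet B) : IsStarProjection (spectralProjection π hB) := by
  have hs : (spectralProjection π hB).toLinearMap.IsSymmetric := by
    rw [LinearMap.isSymmetric_iff_inner_map_self_real]
    intro v
    rw [inner_conj_symm]
    change inner ℂ v (spectralProjection π hB v) = _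
    rw [← inner_conj_symm]
    change _ = inner ℂ (spectralProjection π hB v) v
    rw [← inner_conj_symm (spectralProjection π hB v) v, inner_spectralProjection]
    simp
  have hsa : IsSelfAdjoint (spectralProjection π hB) :=
    ContinuousLinearMap.isSelfAdjoint_iff_isSymmetric.2 hs
  refine ⟨?_, hsa⟩
  rw [IsIdempotentElem, ← sub_eq_zero]
  have key : ∀ v, inner ℂ ((spectralProjection π hB * spectralProjection π hB -
      spectralProjection π hB) v) v = 0 := by
    intro v
    rw [_root_.sub_apply, mul_apply_eq_comp, inner_sub_left]
    have h1 : inner ℂ (spectralProjection π hB (spectralProjection π hB v)) v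
        = inner ℂ (spectralProjection π hB v) (spectralProjection π hB v) := hs _ _
    have h2 : inner ℂ (spectralProjection π hB v) v = inner ℂ v (spectralProjection π hB v) :=
      hs _ _
    rw [h1, h2, inner_spectralProjection, inner_self_eq_norm_sq_to_K,
      ← norm_projectionLinear_sq π hB]
    simp [spectralProjection]
  exact ContinuousLinearMap.coe_inj.1 ((inner_map_self_eq_zero _).1 key)

lemma spectralProjection_univ (π : C(S, ℂ) →⋆ₐ[ℂ] (V →L[ℂ] V)) :
    spectralProjection π (MeasurableSet.univ : MeasurableSet (univ : Set S)) = 1 := by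
  ext v
  rw [spectralProjection_apply]
  have : indicatorConstLp 2 MeasurableSet.univ (measure_ne_top (scalarMeasure π v) _) (1 : ℂ)
      = toL2 (scalarMeasure π v) 1 := by
    refine Lp.ext (indicatorConstLp_coeFn.trans ?_)
    refine EventuallyEq.trans ?_
      (ContinuousMap.coeFn_toLp (𝕜 := ℂ) (p := 2) (scalarMeasure π v) (1 : C(S, ℂ))).symm
    exact .of_forall fun x => by simp
  rw [this, extendAt_toL2, map_one]

/-- The partial sums are indicators of finite unions, and what these miss of the whole union has
measure at most the tail of a convergent series. -/
lemma hasSum_indicatorConstLp (ρ : Measure S) [IsFiniteMeasure ρ] {B : ℕ → Set S}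
    (hB : ∀ i, MeasurableSet (B i)) (hd : Pairwise (Function.onFun Disjoint B)) :
    HasSum (fun i => indicatorConstLp 2 (hB i) (measure_ne_top ρ _) (1 : ℂ))
      (indicatorConstLp 2 (MeasurableSet.iUnion hB) (measure_ne_top ρ _) (1 : ℂ)) := by
  have hm : ∀ s : Finset ℕ, MeasurableSet (⋃ i ∈ s, B i) := fun s => s.measurableSet_biUnion
    fun i _ => hB i
  have hsum : ∀ s : Finset ℕ, ∑ i ∈ s, indicatorConstLp 2 (hB i) (measure_ne_top ρ _) (1 : ℂ)
      = indicatorConstLp 2 (hm s) (measure_ne_top ρ _) (1 : ℂ) := by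
    classical
    intro s
    induction s using Finset.induction_on with
    | empty => simp
    | insert a s ha ih =>
      rw [Finset.sum_insert ha, ih, ← indicatorConstLp_disjoint_union]
      · congr 1
        simp
      · exact disjoint_iUnion₂_right.2 fun i hi => hd fun h => ha (h ▸ hi)
  rw [HasSum]
  simp only [hsum]
  refine tendsto_indicatorConstLp_set (by norm_num) ?_
  have hfin : ∑' i, ρ (B i) ≠ ∞ := by
    rw [← measure_iUnion hd hB]
    exact measure_ne_top _ _
  refine tendsto_of_tendsto_of_tendsto_of_le_of_le tendsto_const_nhds
    (ENNReal.tendsto_tsum_compl_atTop_zero hfin) (fun _ => zero_le) fun s => ?_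
  refine (measure_mono ?_).trans (measure_iUnion_le _)
  rintro x (⟨hx, hx'⟩ | ⟨hx, hx'⟩)
  · obtain ⟨i, -, hi⟩ := mem_iUnion₂.1 hx
    exact absurd (mem_iUnion.2 ⟨i, hi⟩) hx'
  · obtain ⟨i, hi⟩ := mem_iUnion.1 hx
    exact mem_iUnion.2 ⟨⟨i, fun h => hx' (mem_iUnion₂.2 ⟨i, h, hi⟩)⟩, hi⟩

lemma hasSum_spectralProjection (π : C(S, ℂ) →⋆ₐ[ℂ] (V →L[ℂ] V)) {B : ℕ → Set S}
    (hB : ∀ i, MeasurableSet (B i)) (hd : Pairwise (Function.onFun Disjoint B)) (v : V) :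
    HasSum (fun i => spectralProjection π (hB i) v)
      (spectralProjection π (MeasurableSet.iUnion hB) v) := by
  simp only [spectralProjection_apply]
  refine ContinuousLinearMap.hasSum (extendAt π v) ?_
  exact hasSum_indicatorConstLp (scalarMeasure π v) hB hd

end Representation

end IDS

namespace IDS

/-! ### The spectral family of a bounded selfadjoint operator -/

section SpectralFamily

variable {V : Type*} [NormedAddCommGroup V] [InnerProductSpace ℂ V] [CompleteSpace V]

lemma spectrum_subset_closedBall {T : V →L[ℂ] V} {r : ℝ} (hr : ‖T‖ ≤ r) :
    spectrum ℂ T ⊆ Metric.closedBall 0 r := by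
  -- On the zero space the identity has norm zero, so the general bound of the spectrum by the norm
  -- is not available there; the spectrum is empty.
  rcases subsingleton_or_nontrivial V with h | h
  · have : Subsingleton (V →L[ℂ] V) := ⟨fun a b => by ext v; exact Subsingleton.elim _ _⟩
    rw [spectrum.of_subsingleton]
    exact empty_subset _
  · exact (spectrum.subset_closedBall_norm T).trans (Metric.closedBall_subset_closedBall hr)

/-- The functional calculus of a selfadjoint operator of norm at most `r`, for the continuous
functions on the disc of radius `r`. -/
def discHom {T : V →L[ℂ] V} (hT : IsSelfAdjoint T) {r : ℝ} (hr : ‖T‖ ≤ r) :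
    C(Metric.closedBall (0 : ℂ) r, ℂ) →⋆ₐ[ℂ] (V →L[ℂ] V) :=
  cfcHomSuperset hT.isStarNormal (spectrum_subset_closedBall hr)

instance compactSpace_closedBall (r : ℝ) : CompactSpace (Metric.closedBall (0 : ℂ) r) :=
  isCompact_iff_compactSpace.1 (isCompact_closedBall _ _)

lemma discHom_restrict {T : V →L[ℂ] V} (hT : IsSelfAdjoint T) {r : ℝ} (hr : ‖T‖ ≤ r)
    (f : C(ℂ, ℂ)) : discHom hT hr (f.restrict _) = cfc f T := by
  have := hT.isStarNormal
  rw [cfc_apply f T, discHom, cfcHomSuperset_apply]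
  rfl

lemma discHom_id {T : V →L[ℂ] V} (hT : IsSelfAdjoint T) {r : ℝ} (hr : ‖T‖ ≤ r) :
    discHom hT hr (.restrict _ (.id ℂ)) = T :=
  cfcHomSuperset_id _ _

/-- Since (T + T*) / 2 = T, the real part can stand for the identity function. The measures on the
disc can therefore be pushed forward to ℝ by `discRe` without locating the spectrum on the real
line. -/
lemma discHom_re {T : V →L[ℂ] V} (hT : IsSelfAdjoint T) {r : ℝ} (hr : ‖T‖ ≤ r) :
    discHom hT hr ⟨fun z => ((z : ℂ).re : ℂ), by fun_prop⟩ = T := by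
  have h : (⟨fun z => ((z : ℂ).re : ℂ), by fun_prop⟩ : C(Metric.closedBall (0 : ℂ) r, ℂ))
      = (2⁻¹ : ℂ) • (.restrict _ (.id ℂ) + star (.restrict _ (.id ℂ))) := by
    ext z
    simp [Complex.re_eq_add_conj, div_eq_inv_mul, mul_add]
  rw [h, map_smul, map_add, map_star, discHom_id, hT.star_eq, ← two_smul ℂ T, smul_smul]
  norm_num

/-- The real part of a point of the disc. -/
def discRe (r : ℝ) (z : Metric.closedBall (0 : ℂ) r) : ℝ := (z : ℂ).re

lemma continuous_discRe (r : ℝ) : Continuous (discRe r) := by unfold discRe; fun_prop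

/-- A selfadjoint operator has a spectral family, with scalar spectral measures that represent
the functional calculus. -/
theorem exists_isSpectralFamily {T : V →L[ℂ] V} (hT : IsSelfAdjoint T) :
    ∃ (E : Set ℝ → V →L[ℂ] V) (ρ : V → Measure ℝ), IsSpectralFamily T E ∧
      (∀ v, IsFiniteMeasure (ρ v)) ∧
      (∀ (v : V) (φ : C_c(ℝ, ℂ)), ∫ t, φ t ∂ρ v = inner ℂ v (cfc (fun z : ℂ => φ z.re) T v)) ∧
      ∀ (v : V) (B : Set ℝ), MeasurableSet B → inner ℂ v (E B v) = (((ρ v).real B : ℝ) : ℂ) := by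
  classical
  have hm := (continuous_discRe ‖T‖).measurable
  let π := discHom hT le_rfl
  let ρ : V → Measure ℝ := fun v => (scalarMeasure π v).map (discRe ‖T‖)
  -- Only Borel sets matter; zero is a default value elsewhere.
  let E : Set ℝ → V →L[ℂ] V := fun B =>
    if hB : MeasurableSet B then spectralProjection π (hm hB) else 0
  have hE : ∀ {B} (hB : MeasurableSet B), E B = spectralProjection π (hm hB) := fun hB => by
    simp only [E, dif_pos hB]
  have hinner : ∀ (v : V) (B : Set ℝ), MeasurableSet B →
      inner ℂ v (E B v) = (((ρ v).real B : ℝ) : ℂ) := fun v B hB => by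
    rw [hE hB, inner_spectralProjection, map_measureReal_apply hm hB]
  have hfin : ∀ v, IsFiniteMeasure (ρ v) := fun v => inferInstance
  refine ⟨E, ρ, ⟨?_, ?_, ?_, ?_⟩, hfin, ?_, hinner⟩
  · intro B hB
    rw [hE hB]
    exact isStarProjection_spectralProjection π _
  · rw [hE MeasurableSet.univ]
    exact spectralProjection_univ π
  · intro B hB hd v
    have h := hasSum_spectralProjection π (fun i => hm (hB i))
      (fun i j hij => (hd hij).preimage _) v
    rw [hE (MeasurableSet.iUnion hB)]
    simp only [fun i => hE (hB i)]
    convert h using 2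
    simp only [preimage_iUnion]
  · intro v
    refine ⟨ρ v, hfin v, fun B hB => hinner v B hB, ?_, ?_⟩
    · refine (integrable_map_measure continuous_id.aestronglyMeasurable hm.aemeasurable).2 ?_
      exact (continuous_discRe ‖T‖).integrable_of_hasCompactSupport
        (HasCompactSupport.of_compactSpace _)
    · have h : ∫ t, t ∂ρ v = ∫ z, discRe ‖T‖ z ∂scalarMeasure π v :=
        integral_map hm.aemeasurable continuous_id.aestronglyMeasurable
      rw [h, ← integral_complex_ofReal]
      conv_lhs => rw [← discHom_re hT le_rfl]
      exact (integral_scalarMeasure π v _).symm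
  · intro v φ
    refine (integral_map hm.aemeasurable φ.continuous.aestronglyMeasurable).trans ?_
    have h := discHom_restrict hT le_rfl ⟨fun z : ℂ => φ z.re, by fun_prop⟩
    rw [ContinuousMap.coe_mk] at h
    rw [← h]
    exact integral_scalarMeasure π v (ContinuousMap.restrict _ ⟨fun z : ℂ => φ z.re, by fun_prop⟩)

end SpectralFamily

end IDS

namespace IDS

/-! ### Uniformly discrete sets and their counting measures -/

section PointMeasure

variable {X K : Type*} [MetricSpace X]

/-- A set in which all distances are less than one. -/
def IsSmall (Q : Set X) : Prop := ∀ x ∈ Q, ∀ y ∈ Q, dist x y < 1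

lemma IsSmall.mono {P Q : Set X} (hQ : IsSmall Q) (h : P ⊆ Q) : IsSmall P :=
  fun x hx y hy => hQ x (h hx) y (h hy)

lemma isSmall_ball (x : X) : IsSmall (Metric.ball x (1 / 2)) := fun y hy z hz => by
  rw [Metric.mem_ball] at hy hz
  linarith [dist_triangle_right y z x]

/-- Distinct points of a configuration are too far apart for a small set. This is why small sets
have intensity at most one, and why their indicator functions have a basis vector or zero in almost
every fiber. -/
lemma IsSmall.eq {Q : Set X} (hQ : IsSmall Q) {ω : Config X K} {x y : X} (hx : x ∈ ω.carrier)
    (hy : y ∈ ω.carrier) (hxQ : x ∈ Q) (hyQ : y ∈ Q) : x = y := by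
  by_contra h
  exact absurd (ω.one_le_dist x hx y hy h) (not_le.2 (hQ x hxQ y hyQ))

lemma Config.finite_carrier_inter (ω : Config X K) {C : Set X} (hC : IsCompact C) :
    (ω.carrier ∩ C).Finite := by
  obtain ⟨t, -, ht⟩ := hC.elim_nhds_subcover (fun x => Metric.ball x (1 / 2))
    fun x _ => Metric.ball_mem_nhds x (by norm_num)
  refine (t.finite_toSet.biUnion fun i _ =>
    Set.Subsingleton.finite (s := ω.carrier ∩ Metric.ball i (1 / 2)) ?_).subset ?_
  · exact fun x hx y hy => (isSmall_ball i).eq hx.1 hy.1 hx.2 hy.2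
  · rintro x ⟨hx, hxC⟩
    obtain ⟨i, hi, hxi⟩ := mem_iUnion₂.1 (ht hxC)
    exact mem_iUnion₂.2 ⟨i, hi, hx, hxi⟩

/-- A countable Borel partition into small sets, each contained in a ball of radius `1 / 2`. -/
lemma exists_partition_isSmall (X : Type*) [MetricSpace X] [SecondCountableTopology X]
    [LocallyCompactSpace X] [MeasurableSpace X] [BorelSpace X] :
    ∃ Q U : ℕ → Set X, (∀ i, MeasurableSet (Q i)) ∧ Pairwise (Function.onFun Disjoint Q) ∧
      ⋃ i, Q i = univ ∧ (∀ i, Q i ⊆ U i) ∧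
      ∀ i, IsOpen (U i) ∧ IsSmall (U i) ∧ IsCompact (closure (U i)) := by
  have h : ∀ x : X, ∃ V : Set X, V ∈ 𝓝 x ∧ IsOpen V ∧ IsSmall V ∧ IsCompact (closure V) := by
    intro x
    obtain ⟨C, hC, hx⟩ := exists_compact_mem_nhds x
    refine ⟨interior C ∩ Metric.ball x (1 / 2), ?_, isOpen_interior.inter Metric.isOpen_ball,
      (isSmall_ball x).mono inter_subset_right, ?_⟩
    · exact inter_mem (interior_mem_nhds.2 hx) (Metric.ball_mem_nhds x (by norm_num))
    · exact hC.of_isClosed_subset isClosed_closure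
        (closure_minimal (inter_subset_left.trans interior_subset) hC.isClosed)
  choose V hV hVo hVs hVc using h
  obtain ⟨s, hs, hsV⟩ := TopologicalSpace.countable_cover_nhds hV
  obtain ⟨U, hU, hUP⟩ : ∃ U : ℕ → Set X, ⋃ i, U i = univ ∧
      ∀ i, IsOpen (U i) ∧ IsSmall (U i) ∧ IsCompact (closure (U i)) := by
    rcases s.eq_empty_or_nonempty with rfl | hne
    · refine ⟨fun _ => ∅, by simpa using hsV, fun i => ⟨isOpen_empty, ?_, by simp⟩⟩
      exact fun x hx => hx.elim
    · obtain ⟨f, rfl⟩ := hs.exists_eq_range hne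
      refine ⟨fun i => V (f i), by simpa using hsV, fun i => ⟨hVo _, hVs _, hVc _⟩⟩
  refine ⟨disjointed U, U, ?_, disjoint_disjointed U, by rw [iUnion_disjointed, hU],
    fun i => disjointed_subset U i, hUP⟩
  exact fun i => MeasurableSet.disjointed (fun j => (hUP j).1.measurableSet) i

lemma Config.countable_carrier [SecondCountableTopology X] [LocallyCompactSpace X]
    [MeasurableSpace X] [BorelSpace X] (ω : Config X K) : Countable ω.carrier := by
  obtain ⟨Q, U, -, -, hQ, hQU, hU⟩ := exists_partition_isSmall X
  refine Set.countable_coe_iff.2 (Set.Countable.mono (s₂ := ⋃ i, ω.carrier ∩ Q i) ?_ ?_)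
  · rw [← inter_iUnion, hQ, inter_univ]
  · exact countable_iUnion fun i => Set.Subsingleton.countable fun x hx y hy =>
      ((hU i).2.1.mono (hQU i)).eq hx.1 hy.1 hx.2 hy.2

section Measurability

variable [LocallyCompactSpace X] [SecondCountableTopology X] [MeasurableSpace X] [BorelSpace X]

lemma Config.lintegral_pointMeasure (ω : Config X K) (f : X → ℝ≥0∞) :
    ∫⁻ x, f x ∂ω.pointMeasure = ∑' x : ω.carrier, f x := by
  rw [Config.pointMeasure, lintegral_sum_measure]
  simp

lemma Config.pointMeasure_apply (ω : Config X K) {B : Set X} (hB : MeasurableSet B) :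
    ω.pointMeasure B = ∑' x : ω.carrier, B.indicator 1 (x : X) := by
  rw [Config.pointMeasure, Measure.sum_apply _ hB]
  simp [Measure.dirac_apply' _ hB]

lemma Config.ae_pointMeasure_iff (ω : Config X K) {p : X → Prop} :
    (∀ᵐ x ∂ω.pointMeasure, p x) ↔ ∀ x ∈ ω.carrier, p x := by
  have := ω.countable_carrier
  rw [Config.pointMeasure, Measure.ae_sum_iff]
  simp [ae_dirac_eq]

lemma Config.pointMeasure_le_one (ω : Config X K) {Q : Set X} (hQ : IsSmall Q) :
    ω.pointMeasure Q ≤ 1 := by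
  have := ω.countable_carrier
  rw [Config.pointMeasure, Measure.sum_apply_of_countable]
  simp only [Measure.dirac_apply]
  by_cases h : ∃ x : ω.carrier, (x : X) ∈ Q
  · obtain ⟨x, hx⟩ := h
    rw [tsum_eq_single x]
    · exact indicator_le_self' (f := fun _ => (1 : ℝ≥0∞)) (by simp) _
    · intro y hy
      refine indicator_of_notMem (fun hyQ => hy ?_) _
      exact Subtype.ext (hQ.eq y.2 x.2 hyQ hx)
  · push Not at h
    simp [h]

variable [TopologicalSpace K] [CompactSpace K] [T2Space K]

omit [SecondCountableTopology X] [MeasurableSpace X] [BorelSpace X] in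
-- The vague topology tests pairs of points, not single points. The factor max(0, 1 - d(x, y))
-- removes the pairs off the diagonal, whose distance is at least one, and a cutoff in y equal to
-- one on the support of u makes the test function compactly supported, as K is compact.
lemma continuous_sum_carrier (u : C_c(X, ℝ)) :
    Continuous fun ω : Config X K => ∑ᶠ x : ω.carrier, (u x : ℂ) := by
  obtain ⟨v, hv1, -, hvc, -⟩ := exists_continuous_one_zero_of_isCompact (s := tsupport u)
    (t := ∅) u.hasCompactSupport isClosed_empty (disjoint_empty _)
  let F : X × X × K → ℂ := fun p => ((u p.1 * v p.2.1 * max 0 (1 - dist p.1 p.2.1) : ℝ) : ℂ)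
  have hF : Continuous F := by
    have := u.continuous
    fun_prop
  have hFc : HasCompactSupport F := by
    refine HasCompactSupport.intro'
      ((u.hasCompactSupport : IsCompact (tsupport u)).prod
        ((hvc : IsCompact (tsupport v)).prod (isCompact_univ (X := K)))) ?_ ?_
    · exact (isClosed_tsupport _).prod ((isClosed_tsupport _).prod isClosed_univ)
    · rintro ⟨x, y, k⟩ h
      simp only [mem_prod, mem_univ, and_true, not_and_or] at h
      rcases h with h | h
      · simp [F, image_eq_zero_of_notMem_tsupport h]
      · simp [F, image_eq_zero_of_notMem_tsupport h]
  let Φ : C_c(X × X × K, ℂ) := ⟨⟨F, hF⟩, hFc⟩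
  have h0 : Continuous fun ω : Config X K =>
      ∑ᶠ p : ω.carrier × ω.carrier, Φ ((p.1 : X), (p.2 : X), ω.h p.1 p.2) :=
    continuous_iInf_dom (i := Φ) continuous_induced_dom
  refine h0.congr fun ω => ?_
  let d : ω.carrier → ω.carrier × ω.carrier := fun x => (x, x)
  have hd : Function.Injective d := fun x y h => congrArg Prod.fst h
  rw [← finsum_mem_univ, finsum_mem_inter_support_eq' _ _ (range d), finsum_mem_range hd]
  · refine finsum_congr fun x => ?_
    change F _ = _
    by_cases hx : u (x : X) = 0
    · simp [F, d, hx]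
    · have := hv1 (subset_tsupport _ (Function.mem_support.2 hx))
      simp [F, d, this]
  · rintro ⟨x, y⟩ h
    simp only [mem_univ, true_iff]
    by_cases hxy : x = y
    · exact ⟨x, by simp [d, hxy]⟩
    · have := ω.one_le_dist x x.2 y y.2 fun e => hxy (Subtype.ext e)
      refine absurd ?_ (Function.mem_support.1 h)
      change F _ = 0
      simp [F, max_eq_left (sub_nonpos.2 this)]

omit [LocallyCompactSpace X] [SecondCountableTopology X] [TopologicalSpace K] [CompactSpace K]
  [T2Space K] in
lemma Config.lintegral_ofReal (ω : Config X K) (u : C_c(X, ℝ)) (hu : ∀ x, 0 ≤ u x) :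
    ∫⁻ x, ENNReal.ofReal (u x) ∂ω.pointMeasure =
      ENNReal.ofReal (∑ᶠ x : ω.carrier, (u x : ℂ)).re := by
  have hfin : (Function.support fun x : ω.carrier => u x).Finite := by
    refine Set.Finite.of_finite_image ((ω.finite_carrier_inter u.hasCompactSupport).subset ?_)
      Subtype.val_injective.injOn
    rintro _ ⟨x, hx, rfl⟩
    exact ⟨x.2, subset_tsupport _ hx⟩
  rw [Config.pointMeasure, lintegral_sum_measure]
  have h1 : ∀ x : ω.carrier, ∫⁻ y, ENNReal.ofReal (u y) ∂Measure.dirac (x : X)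
      = ENNReal.ofReal (u x) := fun x => lintegral_dirac' _ (by
        have := u.continuous.measurable
        fun_prop)
  simp only [h1]
  rw [tsum_eq_sum (s := hfin.toFinset), finsum_eq_sum_of_support_subset (s := hfin.toFinset),
    Complex.re_sum, ENNReal.ofReal_sum_of_nonneg]
  · simp
  · exact fun x _ => hu x
  · intro x hx
    simpa using hx
  · intro x hx
    simp only [Finite.mem_toFinset, Function.mem_support, not_not] at hx
    simp [hx]

/-- W is an increasing union of compact sets F n, and Urysohn functions lie between the indicators
of F n and W. The count in W is thus a supremum of continuous functions of ω. -/
lemma measurable_pointMeasure_apply_isOpen {W : Set X} (hW : IsOpen W)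
    (hWc : IsCompact (closure W)) : Measurable fun ω : Config X K => ω.pointMeasure W := by
  obtain ⟨F, hFc, hFW, hF, hmono⟩ := hW.exists_iUnion_isClosed
  have h : ∀ n, ∃ f : C(X, ℝ), EqOn f 1 (F n) ∧ EqOn f 0 Wᶜ ∧ HasCompactSupport f ∧
      ∀ x, f x ∈ Icc (0 : ℝ) 1 := fun n =>
    exists_continuous_one_zero_of_isCompact
      (hWc.of_isClosed_subset (hFc n) ((hFW n).trans subset_closure)) hW.isClosed_compl
      (disjoint_compl_right_iff_subset.2 (hFW n))
  choose f h1 h0 hc h01 using h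
  let u : ℕ → C_c(X, ℝ) := fun n => ⟨f n, hc n⟩
  have key : ∀ ω : Config X K, ω.pointMeasure W
      = ⨆ n, ENNReal.ofReal (∑ᶠ x : ω.carrier, (u n x : ℂ)).re := by
    intro ω
    simp only [← fun n => ω.lintegral_ofReal (u n) fun x => (h01 n x).1]
    refine le_antisymm ?_ (iSup_le fun n => ?_)
    · rw [← hF, hmono.measure_iUnion]
      refine iSup_mono fun n => ?_
      rw [← lintegral_indicator_one (hFc n).measurableSet]
      refine lintegral_mono fun x => ?_
      by_cases hx : x ∈ F n
      · have : u n x = 1 := h1 n hx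
        simp [hx, this]
      · simp [hx]
    · rw [← lintegral_indicator_one hW.measurableSet]
      refine lintegral_mono fun x => ?_
      by_cases hx : x ∈ W
      · have : u n x ≤ 1 := (h01 n x).2
        simpa [hx] using this
      · have : u n x = 0 := h0 n hx
        simp [this]
  simp only [key]
  refine Measurable.iSup fun n => ?_
  exact ENNReal.measurable_ofReal.comp
    (Complex.measurable_re.comp (continuous_sum_carrier (K := K) (u n)).measurable)

/-- The open sets form a π-system, which determines finite measures. The counting measure is at most
one on each `U i`, which is open, so that intersections of open sets with it stay open; the Borel
partition `Q i` inside the `U i` then reassembles the whole measure. -/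
lemma measurable_pointMeasure :
    Measurable fun ω : Config X K => (ω.pointMeasure : Measure X) := by
  obtain ⟨Q, U, hQm, hQd, hQ, hQU, hU⟩ := exists_partition_isSmall X
  have hloc : ∀ i, Measurable fun ω : Config X K => (ω.pointMeasure.restrict (U i)) := by
    intro i
    have : ∀ ω : Config X K, IsFiniteMeasure (ω.pointMeasure.restrict (U i)) := fun ω =>
      ⟨by
        rw [Measure.restrict_apply_univ]
        exact (ω.pointMeasure_le_one (hU i).2.1).trans_lt ENNReal.one_lt_top⟩
    have hopen : ∀ s : Set X, IsOpen s →
        Measurable fun ω : Config X K => ω.pointMeasure.restrict (U i) s := by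
      intro s hs
      simp only [Measure.restrict_apply hs.measurableSet]
      refine measurable_pointMeasure_apply_isOpen (hs.inter (hU i).1) ?_
      exact (hU i).2.2.of_isClosed_subset isClosed_closure (closure_mono inter_subset_right)
    exact Measurable.measure_of_isPiSystem (BorelSpace.measurable_eq (α := X)) isPiSystem_isOpen
      hopen (hopen univ isOpen_univ)
  have hsum : ∀ ω : Config X K, (ω.pointMeasure : Measure X)
      = Measure.sum fun i => (ω.pointMeasure.restrict (U i)).restrict (Q i) := by
    intro ω
    conv_lhs => rw [← Measure.restrict_univ (μ := ω.pointMeasure), ← hQ,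
      Measure.restrict_iUnion hQd hQm]
    congr 1
    funext i
    rw [Measure.restrict_restrict (hQm i), inter_eq_left.2 (hQU i)]
  refine Measure.measurable_of_measurable_coe _ fun B hB => ?_
  have : ∀ ω : Config X K, ω.pointMeasure B
      = ∑' i, ω.pointMeasure.restrict (U i) (B ∩ Q i) := by
    intro ω
    conv_lhs => rw [hsum ω, Measure.sum_apply _ hB]
    simp only [Measure.restrict_apply hB]
  simp only [this]
  exact Measurable.tsum fun i =>
    (Measure.measurable_coe (hB.inter (hQm i))).comp (hloc i)

/-- The kernel of counting measures. -/
def pointKernel (X K : Type*) [MetricSpace X] [LocallyCompactSpace X] [SecondCountableTopology X]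
    [MeasurableSpace X] [BorelSpace X] [TopologicalSpace K] [CompactSpace K] [T2Space K] :
    ProbabilityTheory.Kernel (Config X K) X :=
  ⟨fun ω => ω.pointMeasure, measurable_pointMeasure⟩

lemma pointKernel_apply (ω : Config X K) : pointKernel X K ω = ω.pointMeasure := rfl

instance : ProbabilityTheory.IsSFiniteKernel (pointKernel X K) := by
  obtain ⟨Q, U, hQm, hQd, hQ, hQU, hU⟩ := exists_partition_isSmall X
  have : pointKernel X K
      = ProbabilityTheory.Kernel.sum fun i => (pointKernel X K).restrict (hQm i) := by
    ext1 ω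
    rw [ProbabilityTheory.Kernel.sum_apply]
    simp only [ProbabilityTheory.Kernel.restrict_apply]
    rw [← Measure.restrict_iUnion hQd hQm, hQ, Measure.restrict_univ]
  have hfin : ∀ i, ProbabilityTheory.IsFiniteKernel ((pointKernel X K).restrict (hQm i)) := by
    intro i
    refine ⟨1, ENNReal.one_lt_top, fun ω => ?_⟩
    rw [ProbabilityTheory.Kernel.restrict_apply, Measure.restrict_apply_univ]
    exact ω.pointMeasure_le_one ((hU i).2.1.mono (hQU i))
  rw [this]
  infer_instance

end Measurability

end PointMeasure

end IDS

namespace IDS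

/-! ### The measures induced by an invariant measure -/

section Induced

variable {X K Γ : Type*} [MetricSpace X] [LocallyCompactSpace X] [SecondCountableTopology X]
  [MeasurableSpace X] [BorelSpace X] [TopologicalSpace K] [CompactSpace K] [T2Space K]

/-- Gives access to the theorems of Tonelli and Fubini for kernels. -/
lemma fiberMeasure_eq_compProd (μ : Measure (Config X K)) [SFinite μ] :
    fiberMeasure μ = μ.compProd (pointKernel X K) := by
  have hmeas : Measurable fun ω : Config X K => ω.pointMeasure.map (Prod.mk ω) := by
    refine Measure.measurable_of_measurable_coe _ fun s hs => ?_
    simp only [Measure.map_apply measurable_prodMk_left hs]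
    exact ProbabilityTheory.Kernel.measurable_kernel_prodMk_left (κ := pointKernel X K) hs
  ext s hs
  rw [fiberMeasure, Measure.bind_apply hs hmeas.aemeasurable, Measure.compProd_apply hs]
  refine lintegral_congr fun ω => ?_
  rw [Measure.map_apply measurable_prodMk_left hs, pointKernel_apply]

lemma intensity_apply (μ : Measure (Config X K)) {B : Set X} (hB : MeasurableSet B) :
    intensity μ B = ∫⁻ ω, ω.pointMeasure B ∂μ := by
  rw [intensity, Measure.bind_apply hB measurable_pointMeasure.aemeasurable]

variable (μ : Measure (Config X K)) [SFinite μ]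

instance : SFinite (fiberMeasure μ) := by
  rw [fiberMeasure_eq_compProd]
  infer_instance

lemma lintegral_fiberMeasure {f : Config X K × X → ℝ≥0∞} (hf : Measurable f) :
    ∫⁻ p, f p ∂fiberMeasure μ = ∫⁻ ω, ∫⁻ x, f (ω, x) ∂ω.pointMeasure ∂μ := by
  rw [fiberMeasure_eq_compProd, Measure.lintegral_compProd hf]
  rfl

lemma map_snd_fiberMeasure : (fiberMeasure μ).map Prod.snd = intensity μ := by
  ext s hs
  rw [Measure.map_apply measurable_snd hs, fiberMeasure_eq_compProd,
    Measure.compProd_apply (measurable_snd hs), intensity_apply μ hs]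
  rfl

lemma measurePreserving_snd : MeasurePreserving Prod.snd (fiberMeasure μ) (intensity μ) :=
  ⟨measurable_snd, map_snd_fiberMeasure μ⟩

instance : SFinite (intensity μ) := by
  rw [← map_snd_fiberMeasure]
  infer_instance

variable {μ} in
-- Every point of X(ω) has positive counting measure, so a property that holds almost everywhere in
-- the fiber holds at all its points.
lemma ae_carrier_of_ae {p : Config X K × X → Prop} (h : ∀ᵐ z ∂fiberMeasure μ, p z) :
    ∀ᵐ ω ∂μ, ∀ x ∈ ω.carrier, p (ω, x) := by
  rw [fiberMeasure_eq_compProd] at h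
  filter_upwards [Measure.ae_ae_of_ae_compProd h] with ω hω
  exact ω.ae_pointMeasure_iff.1 hω

variable {μ} in
lemma integrable_fiber {f : Config X K × X → ℂ} (hf : Integrable f (fiberMeasure μ)) :
    Integrable (fun ω : Config X K => ∫ x, f (ω, x) ∂ω.pointMeasure) μ := by
  rw [fiberMeasure_eq_compProd] at hf
  rw [Measure.compProd] at hf
  exact hf.integral_compProd

variable {μ} in
lemma integral_fiberMeasure {f : Config X K × X → ℂ} (hf : Integrable f (fiberMeasure μ)) :
    ∫ p, f p ∂fiberMeasure μ = ∫ ω, ∫ x, f (ω, x) ∂ω.pointMeasure ∂μ := by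
  rw [fiberMeasure_eq_compProd] at hf ⊢
  rw [Measure.integral_compProd hf]
  rfl

lemma intensity_le_one [IsProbabilityMeasure μ] {Q : Set X} (hQ : IsSmall Q)
    (hm : MeasurableSet Q) : intensity μ Q ≤ 1 := by
  rw [intensity_apply μ hm]
  refine (lintegral_mono fun ω => ω.pointMeasure_le_one hQ).trans ?_
  simp

instance [IsProbabilityMeasure μ] : IsFiniteMeasureOnCompacts (intensity μ) := by
  refine ⟨fun C hC => hC.measure_lt_top_of_nhdsWithin fun x _ => ?_⟩
  exact ⟨_, mem_nhdsWithin_of_mem_nhds (Metric.ball_mem_nhds x (by norm_num)),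
    (intensity_le_one μ (isSmall_ball x) measurableSet_ball).trans_lt ENNReal.one_lt_top⟩

/-- If a bump function u is one at a point of ω₀, then ω ↦ ∑ u(x) is continuous and positive at ω₀,
hence positive on a neighborhood. For ω₀ in the support this neighborhood has positive measure, and
its configurations are nonempty. -/
lemma intensity_univ_ne_zero (hΩ : ∃ ω ∈ μ.support, ω.carrier.Nonempty) :
    intensity μ univ ≠ 0 := by
  obtain ⟨ω₀, hω₀, x₀, hx₀⟩ := hΩ
  obtain ⟨f, hf1, -, hfc, hf01⟩ := exists_continuous_one_zero_of_isCompact (s := {x₀}) (t := ∅)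
    isCompact_singleton isClosed_empty (disjoint_empty _)
  let u : C_c(X, ℝ) := ⟨f, hfc⟩
  have hu0 : ∀ x, 0 ≤ u x := fun x => (hf01 x).1
  have hux : u x₀ = 1 := hf1 rfl
  have hω₀u : 0 < (∑ᶠ x : ω₀.carrier, (u x : ℂ)).re := by
    rw [← ENNReal.ofReal_pos, ← ω₀.lintegral_ofReal u hu0, ω₀.lintegral_pointMeasure]
    refine lt_of_lt_of_le ?_ (ENNReal.le_tsum ⟨x₀, hx₀⟩)
    simp [hux]
  have hopen : {ω : Config X K | 0 < (∑ᶠ x : ω.carrier, (u x : ℂ)).re} ∈ 𝓝 ω₀ :=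
    (isOpen_lt continuous_const
      (Complex.continuous_re.comp (continuous_sum_carrier u))).mem_nhds hω₀u
  have hpos := (Measure.mem_support_iff_forall ω₀).1 hω₀ _ hopen
  intro h0
  have hm : Measurable fun ω : Config X K => ω.pointMeasure univ :=
    (Measure.measurable_coe MeasurableSet.univ).comp measurable_pointMeasure
  rw [intensity_apply μ MeasurableSet.univ, lintegral_eq_zero_iff hm] at h0
  refine hpos.ne' (measure_mono_null ?_ (ae_iff.1 h0))
  intro ω hω h
  have : ω.pointMeasure = 0 := Measure.measure_univ_eq_zero.1 h
  have h2 := ω.lintegral_ofReal u hu0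
  rw [this, lintegral_zero_measure] at h2
  exact (ENNReal.ofReal_pos.2 hω).ne h2

section Action

variable [Group Γ] [MulAction Γ X] [IsIsometricSMul Γ X]

/-- Translation by `γ`, as a bijection from `X(ω)` to `X(γ ω)`. -/
def Config.smulEquiv (γ : Γ) (ω : Config X K) : ω.carrier ≃ (γ • ω).carrier where
  toFun := ω.smulPoint γ
  invFun y := ⟨γ⁻¹ • (y : X), y.2⟩
  left_inv x := Subtype.ext (inv_smul_smul γ (x : X))
  right_inv y := Subtype.ext (smul_inv_smul γ (y : X))

lemma measurable_smul_const (γ : Γ) : Measurable fun x : X => γ • x :=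
  (isometry_smul X γ).continuous.measurable

lemma Config.pointMeasure_smul (γ : Γ) (ω : Config X K) :
    (γ • ω).pointMeasure = ω.pointMeasure.map fun x => γ • x := by
  ext s hs
  rw [Measure.map_apply (measurable_smul_const γ) hs, Config.pointMeasure_apply _ hs,
    Config.pointMeasure_apply _ (measurable_smul_const γ hs), ← (ω.smulEquiv γ).tsum_eq]
  rfl

/-- The diagonal action on pairs `(ω, x)`. -/
def pairSMul (γ : Γ) (p : Config X K × X) : Config X K × X := (γ • p.1, γ • p.2)

variable {μ} in
-- The counting measure of γω is the image under γ of that of ω, so the invariance of μ passes to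
-- pairs.
lemma measurePreserving_pairSMul {γ : Γ}
    (hγ : MeasurePreserving (fun ω : Config X K => γ • ω) μ μ) :
    MeasurePreserving (pairSMul γ) (fiberMeasure μ) (fiberMeasure μ) := by
  have hm : Measurable (pairSMul γ : Config X K × X → Config X K × X) :=
    (hγ.measurable.comp measurable_fst).prodMk ((measurable_smul_const γ).comp measurable_snd)
  refine ⟨hm, ?_⟩
  ext s hs
  have hs' : Measurable (s.indicator (1 : Config X K × X → ℝ≥0∞)) :=
    measurable_one.indicator hs
  rw [← lintegral_indicator_one hs, lintegral_map hs' hm,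
    ← lintegral_indicator_one hs, lintegral_fiberMeasure μ hs']
  refine (lintegral_fiberMeasure μ (hs'.comp hm)).trans ?_
  have h1 : Measurable fun ω : Config X K =>
      ∫⁻ x, s.indicator (1 : Config X K × X → ℝ≥0∞) (ω, x) ∂ω.pointMeasure :=
    Measurable.lintegral_kernel_prod_right' (κ := pointKernel X K) hs'
  rw [← hγ.lintegral_comp h1]
  refine lintegral_congr fun ω => ?_
  rw [Config.pointMeasure_smul]
  exact (lintegral_map (hs'.comp (measurable_prodMk_left (x := γ • ω)))
    (measurable_smul_const γ)).symm

variable {μ} in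
lemma measurePreserving_smul_intensity {γ : Γ}
    (hγ : MeasurePreserving (fun ω : Config X K => γ • ω) μ μ) :
    MeasurePreserving (fun x : X => γ • x) (intensity μ) (intensity μ) := by
  refine ⟨measurable_smul_const γ, ?_⟩
  have h := (measurePreserving_pairSMul hγ).map_eq
  conv_lhs => rw [← map_snd_fiberMeasure μ,
    Measure.map_map (measurable_smul_const γ) measurable_snd]
  conv_rhs => rw [← map_snd_fiberMeasure μ, ← h,
    Measure.map_map measurable_snd (measurePreserving_pairSMul hγ).measurable]
  rfl

end Action

end Induced

end IDS

namespace IDS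

/-! ### Fundamental domains and averaging over the group -/

section Group

variable {Γ : Type*} [Group Γ] [MetricSpace Γ] [IsTopologicalGroup Γ]
  [ProperSpace Γ] [IsIsometricSMul Γ Γ] [MeasurableSpace Γ] [BorelSpace Γ]
  (vol : Measure Γ) [vol.IsHaarMeasure]

lemma measure_unitBall_ne_zero : vol (Metric.closedBall (1 : Γ) 1) ≠ 0 :=
  (Metric.measure_closedBall_pos vol _ one_pos).ne'

lemma measure_unitBall_ne_top : vol (Metric.closedBall (1 : Γ) 1) ≠ ∞ :=
  measure_closedBall_lt_top.ne

lemma inv_unitBall : (Metric.closedBall (1 : Γ) 1)⁻¹ = Metric.closedBall (1 : Γ) 1 := by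
  ext γ
  rw [Set.mem_inv, Metric.mem_closedBall, Metric.mem_closedBall]
  have := dist_smul γ γ⁻¹ (1 : Γ)
  rw [smul_eq_mul, smul_eq_mul, mul_inv_cancel, mul_one, dist_comm] at this
  rw [this]

/-- Inversion turns the right invariant measure into a left invariant one, hence into a multiple of
itself. The factor is one because the unit ball of a left invariant metric is symmetric. -/
lemma isInvInvariant_of_unimodular [vol.IsMulRightInvariant] : vol.IsInvInvariant := by
  have : IsFiniteMeasureOnCompacts vol.inv := by
    refine ⟨fun C hC => ?_⟩
    rw [Measure.inv_apply]
    exact hC.inv.measure_lt_top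
  have h := Measure.isMulLeftInvariant_eq_smul vol.inv vol
  have h1 := congrArg (fun m : Measure Γ => m (Metric.closedBall (1 : Γ) 1)) h
  simp only [Measure.inv_apply, inv_unitBall, Measure.smul_apply] at h1
  have h2 : (Measure.haarScalarFactor vol.inv vol : ℝ≥0∞) = 1 := by
    rw [ENNReal.smul_def, smul_eq_mul] at h1
    have := (ENNReal.mul_left_inj (measure_unitBall_ne_zero vol)
      (measure_unitBall_ne_top vol)).1 ((one_mul _).trans h1)
    exact this.symm
  have h3 : Measure.haarScalarFactor vol.inv vol = 1 := by exact_mod_cast h2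
  refine ⟨?_⟩
  rw [h, h3, one_smul]

variable {X : Type*} [MetricSpace X] [MulAction Γ X] {F' : Set X}

namespace IsRoughFundamentalDomain

/-- The group element `γ` for which `x ∈ γ F'`. -/
def index (hF : IsRoughFundamentalDomain Γ F') (x : X) : Γ := (hF.existsUnique_mem x).choose

omit [IsTopologicalGroup Γ] [ProperSpace Γ] [IsIsometricSMul Γ Γ] [MeasurableSpace Γ]
  [BorelSpace Γ]

lemma mem_smul_iff (hF : IsRoughFundamentalDomain Γ F') (x : X) (γ : Γ) :
    x ∈ γ • F' ↔ hF.index x = γ :=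
  ⟨fun h => ((hF.existsUnique_mem x).choose_spec.2 γ h).symm,
    fun h => h ▸ (hF.existsUnique_mem x).choose_spec.1⟩

lemma index_smul (hF : IsRoughFundamentalDomain Γ F') (γ : Γ) (x : X) :
    hF.index (γ • x) = γ * hF.index x := by
  rw [← hF.mem_smul_iff, mul_smul]
  exact smul_mem_smul_set ((hF.mem_smul_iff x _).2 rfl)

lemma preimage_index (hF : IsRoughFundamentalDomain Γ F') (I : Set Γ) :
    hF.index ⁻¹' I = I • F' := by
  ext x
  rw [mem_preimage, ← iUnion_smul_set, mem_iUnion₂]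
  simp only [hF.mem_smul_iff]
  simp

end IsRoughFundamentalDomain

variable [ContinuousSMul Γ X] [MeasurableSpace X] [BorelSpace X]

namespace IsRoughFundamentalDomain

/-- The preimage of a closed set C is C F'. Both factors are σ-compact, so it is a countable union
of compact sets. -/
lemma measurable_index (hF : IsRoughFundamentalDomain Γ F') : Measurable hF.index := by
  refine measurable_of_isClosed fun C hC => ?_
  rw [hF.preimage_index]
  obtain ⟨D, hD, rfl⟩ := (isSigmaCompact_univ (X := Γ)).of_isClosed_subset hC (subset_univ _)
  obtain ⟨F, hFc, hFU⟩ := hF.isSigmaCompact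
  conv_rhs => rw [← hFU]
  rw [iUnion_smul]
  simp only [smul_iUnion]
  exact .iUnion fun i => .iUnion fun j => ((hD i).smul_set (hFc j)).measurableSet

lemma measure_smul_lt_top (hF : IsRoughFundamentalDomain Γ F') (m : Measure X)
    [IsFiniteMeasureOnCompacts m] {I : Set Γ} (hI : IsCompact I) : m (I • F') < ∞ :=
  (measure_mono (smul_subset_smul_left subset_closure)).trans_lt
    (hI.smul_set hF.isCompact_closure).measure_lt_top

variable [IsIsometricSMul Γ X]

/-- An invariant measure on `X` is, on unions of translates of the fundamental domain, a multiple
of the Haar measure. -/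
lemma exists_measure_smul_eq (hF : IsRoughFundamentalDomain Γ F') (m : Measure X)
    [IsFiniteMeasureOnCompacts m]
    (hm : ∀ γ : Γ, MeasurePreserving (fun x : X => γ • x) m m) :
    ∃ c : ℝ≥0∞, c ≠ ∞ ∧ ∀ I : Set Γ, MeasurableSet I → m (I • F') = c * vol I := by
  have hmeas := hF.measurable_index
  have h1 : IsFiniteMeasureOnCompacts (m.map hF.index) := by
    refine ⟨fun I hI => ?_⟩
    rw [Measure.map_apply hmeas hI.measurableSet, hF.preimage_index]
    exact hF.measure_smul_lt_top m hI
  have h2 : (m.map hF.index).IsMulLeftInvariant := by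
    refine ⟨fun γ => ?_⟩
    rw [Measure.map_map (measurable_const_mul γ) hmeas]
    conv_rhs => rw [← (hm γ).map_eq, Measure.map_map hmeas (hm γ).measurable]
    congr 1
    funext x
    exact (hF.index_smul γ x).symm
  have h3 := Measure.isMulLeftInvariant_eq_smul (m.map hF.index) vol
  refine ⟨Measure.haarScalarFactor (m.map hF.index) vol, ENNReal.coe_ne_top, fun I hI => ?_⟩
  rw [← hF.preimage_index, ← Measure.map_apply hmeas hI]
  refine (congrArg (fun n : Measure Γ => n I) h3).trans ?_
  rw [Measure.smul_apply, ENNReal.smul_def, smul_eq_mul]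

/-- The density of an invariant measure. -/
lemma density (hF : IsRoughFundamentalDomain Γ F') (m : Measure X)
    [IsFiniteMeasureOnCompacts m]
    (hm : ∀ γ : Γ, MeasurePreserving (fun x : X => γ • x) m m) (h0 : m univ ≠ 0) {d : ℝ≥0∞}
    (hd : d = m (Metric.closedBall (1 : Γ) 1 • F') / vol (Metric.closedBall (1 : Γ) 1)) :
    d ≠ 0 ∧ d ≠ ∞ ∧ ∀ I : Set Γ, IsCompact I → m (I • F') = d * vol I := by
  obtain ⟨c, hc, h⟩ := hF.exists_measure_smul_eq vol m hm
  have hdc : d = c := by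
    rw [hd, h _ measurableSet_closedBall, ENNReal.mul_div_cancel_right
      (measure_unitBall_ne_zero vol) (measure_unitBall_ne_top vol)]
  rw [hdc]
  refine ⟨fun h0' => h0 ?_, hc, fun I hI => h I hI.measurableSet⟩
  have := h univ MeasurableSet.univ
  rwa [h0', zero_mul, ← hF.preimage_index, preimage_univ] at this

/-- The normalized indicator function of `B F'`, for the unit ball `B` of the group. -/
def weight (F' : Set X) (x : X) : ℝ :=
  (vol.real (Metric.closedBall (1 : Γ) 1))⁻¹ *
    (Metric.closedBall (1 : Γ) 1 • F').indicator 1 x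

lemma weight_nonneg (F' : Set X) (x : X) : 0 ≤ weight vol F' x :=
  mul_nonneg (inv_nonneg.2 measureReal_nonneg) (indicator_nonneg (fun _ _ => zero_le_one) x)

lemma measurableSet_smul (hF : IsRoughFundamentalDomain Γ F') {I : Set Γ}
    (hI : MeasurableSet I) : MeasurableSet (I • F') := by
  rw [← hF.preimage_index]
  exact hF.measurable_index hI

lemma measurable_weight (hF : IsRoughFundamentalDomain Γ F') : Measurable (weight vol F') :=
  measurable_const.mul
    (measurable_one.indicator (hF.measurableSet_smul measurableSet_closedBall))

/-- The γ with γx ∈ B F' form the right translate B Φ(x)⁻¹ of the unit ball, which has the measure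
of B by right invariance. -/
lemma integral_weight [vol.IsMulRightInvariant] (hF : IsRoughFundamentalDomain Γ F') (x : X) :
    ∫ γ : Γ, weight vol F' (γ • x) ∂vol = 1 := by
  have h : (fun γ : Γ => weight vol F' (γ • x)) = fun γ =>
      (vol.real (Metric.closedBall (1 : Γ) 1))⁻¹ *
        ((fun γ => γ * hF.index x) ⁻¹' Metric.closedBall (1 : Γ) 1).indicator 1 γ := by
    funext γ
    rw [weight, ← hF.preimage_index]
    congr 1
    have hiff : γ • x ∈ hF.index ⁻¹' Metric.closedBall (1 : Γ) 1 ↔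
        γ ∈ (fun γ => γ * hF.index x) ⁻¹' Metric.closedBall (1 : Γ) 1 := by
      rw [mem_preimage, mem_preimage, hF.index_smul]
    by_cases hγ : γ • x ∈ hF.index ⁻¹' Metric.closedBall (1 : Γ) 1
    · rw [indicator_of_mem hγ, indicator_of_mem (hiff.1 hγ)]
      rfl
    · rw [indicator_of_notMem hγ, indicator_of_notMem (mt hiff.2 hγ)]
  have hB : MeasurableSet (Metric.closedBall (1 : Γ) 1) := measurableSet_closedBall
  rw [h, integral_const_mul, integral_indicator_one (measurable_mul_const _ hB), measureReal_def,
    measureReal_def, measure_preimage_mul_right]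
  exact inv_mul_cancel₀ (ENNReal.toReal_ne_zero.2
    ⟨measure_unitBall_ne_zero vol, measure_unitBall_ne_top vol⟩)

end IsRoughFundamentalDomain

end Group

section Averaging

variable {Γ X : Type*} [Group Γ] [MeasurableSpace Γ] [MeasurableSpace X]
  [MulAction Γ X] [MeasurableSMul₂ Γ X] [MeasurableInv Γ]
  (vol : Measure Γ) [SFinite vol] (m : Measure X) [SFinite m]

variable {m} in
lemma measurePreserving_skew (hm : ∀ γ : Γ, MeasurePreserving (fun x : X => γ • x) m m) :
    MeasurePreserving (fun z : Γ × X => (z.1, z.1 • z.2)) (vol.prod m) (vol.prod m) :=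
  (MeasurePreserving.id vol).skew_product measurable_smul (.of_forall fun γ => (hm γ).map_eq)

variable {m} in
/-- For an invariant measure, `∫ u dm ≤ ∫ v dm` if the translates of `v` average to one, and those
of `u` to at most one. -/
lemma lintegral_le_of_average (hm : ∀ γ : Γ, MeasurePreserving (fun x : X => γ • x) m m)
    {u v : X → ℝ≥0∞} (hu : Measurable u) (hv : Measurable v)
    (hu1 : ∀ x, ∫⁻ γ : Γ, u (γ • x) ∂vol ≤ 1) (hv1 : ∀ x, ∫⁻ γ : Γ, v (γ⁻¹ • x) ∂vol = 1) :
    ∫⁻ x, u x ∂m ≤ ∫⁻ x, v x ∂m := by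
  -- The double integral of u(x) v(γ⁻¹x) is ∫ u dm when γ is integrated first. The substitution x ↦
  -- γx moves the translation from v to u.
  have hmeas : Measurable fun z : Γ × X => u z.2 * v (z.1⁻¹ • z.2) := by fun_prop
  calc ∫⁻ x, u x ∂m = ∫⁻ x, ∫⁻ γ : Γ, u x * v (γ⁻¹ • x) ∂vol ∂m := by
        refine lintegral_congr fun x => ?_
        rw [lintegral_const_mul _ (by fun_prop), hv1, mul_one]
    _ = ∫⁻ z, u z.2 * v (z.1⁻¹ • z.2) ∂vol.prod m :=
        (lintegral_prod_symm' _ hmeas).symm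
    _ = ∫⁻ z, u (z.1 • z.2) * v z.2 ∂vol.prod m := by
        rw [← (measurePreserving_skew vol hm).lintegral_comp hmeas]
        simp
    _ = ∫⁻ x, ∫⁻ γ : Γ, u (γ • x) * v x ∂vol ∂m :=
        lintegral_prod_symm' _ (by fun_prop)
    _ ≤ ∫⁻ x, v x ∂m := by
        refine lintegral_mono fun x => ?_
        rw [lintegral_mul_const _ (by fun_prop)]
        exact mul_le_of_le_one_left zero_le (hu1 x)

/-- Weights of integral one along the orbits give the same integral of an invariant function. -/
lemma integral_eq_of_average {Y : Type*} [MeasurableSpace Y] {M : Measure Y} [SFinite M]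
    {p : Y → X} (hp : MeasurePreserving p M m) {T : Γ → Y → Y}
    (hT : ∀ γ, MeasurePreserving (T γ) M M) (hpT : ∀ γ y, p (T γ y) = γ • p y)
    (hm : ∀ γ : Γ, MeasurePreserving (fun x : X => γ • x) m m)
    {D : Y → ℂ} (hD : AEStronglyMeasurable D M) {C : ℝ} (hDC : ∀ᵐ y ∂M, ‖D y‖ ≤ C)
    (hDT : ∀ γ, ∀ᵐ y ∂M, D (T γ y) = D y)
    {u v : X → ℝ} (hu : Measurable u) (hv : Measurable v) (hui : Integrable u m)
    (hv0 : ∀ x, 0 ≤ v x) (hu1 : ∀ x, ∫ γ : Γ, u (γ • x) ∂vol = 1)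
    (hv1 : ∀ x, ∫ γ : Γ, v (γ⁻¹ • x) ∂vol = 1) :
    ∫ y, (u (p y) : ℂ) * D y ∂M = ∫ y, (v (p y) : ℂ) * D y ∂M := by
  -- An integral equal to one is not the default value zero of a nonintegrable function.
  have hvi : ∀ x, Integrable (fun γ : Γ => v (γ⁻¹ • x)) vol := fun x => by
    by_contra h
    have := hv1 x
    rw [integral_undef h] at this
    exact zero_ne_one this
  have hmeas : Measurable fun z : Γ × X => u z.2 * v (z.1⁻¹ • z.2) := by fun_prop
  have hint1 : Integrable (fun z : Γ × X => u z.2 * v (z.1⁻¹ • z.2)) (vol.prod m) := by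
    rw [integrable_prod_iff' hmeas.aestronglyMeasurable]
    refine ⟨.of_forall fun x => (hvi x).const_mul (u x), ?_⟩
    have : (fun x => ∫ γ : Γ, ‖u x * v (γ⁻¹ • x)‖ ∂vol) = fun x => ‖u x‖ := by
      funext x
      simp only [norm_mul, fun γ : Γ => Real.norm_of_nonneg (hv0 (γ⁻¹ • x))]
      rw [integral_const_mul, hv1, mul_one]
    rw [this]
    exact hui.norm
  have hint2 : Integrable (fun z : Γ × X => u (z.1 • z.2) * v z.2) (vol.prod m) := by
    have := (measurePreserving_skew vol hm).integrable_comp hmeas.aestronglyMeasurable |>.2 hint1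
    simpa [Function.comp_def] using this
  have hpp : MeasurePreserving (Prod.map id p : Γ × Y → Γ × X) (vol.prod M) (vol.prod m) :=
    (MeasurePreserving.id vol).prod hp
  have lift : ∀ w : Γ × X → ℝ, Integrable w (vol.prod m) →
      Integrable (fun z : Γ × Y => (w (z.1, p z.2) : ℂ) * D z.2) (vol.prod M) := by
    intro w hw
    refine Integrable.mul_bdd (c := C) ((hpp.integrable_comp_of_integrable hw).ofReal)
      hD.comp_snd ?_
    exact Measure.quasiMeasurePreserving_snd.ae hDC
  have h1 := lift _ hint1
  have h2 := lift _ hint2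
  calc ∫ y, (u (p y) : ℂ) * D y ∂M
      = ∫ y, ∫ γ : Γ, ((u (p y) * v (γ⁻¹ • p y) : ℝ) : ℂ) * D y ∂vol ∂M := by
        refine integral_congr_ae (.of_forall fun y => ?_)
        simp only
        rw [integral_mul_const, integral_complex_ofReal, integral_const_mul, hv1, mul_one]
    _ = ∫ γ : Γ, ∫ y, ((u (p y) * v (γ⁻¹ • p y) : ℝ) : ℂ) * D y ∂M ∂vol :=
        (integral_integral_swap h1).symm
    _ = ∫ γ : Γ, ∫ y, ((u (γ • p y) * v (p y) : ℝ) : ℂ) * D y ∂M ∂vol := by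
        refine integral_congr_ae (.of_forall fun γ => ?_)
        simp only
        have hsm : AEStronglyMeasurable
            (fun y => ((u (p y) * v (γ⁻¹ • p y) : ℝ) : ℂ) * D y) M := by
          refine AEStronglyMeasurable.mul ?_ hD
          have := hp.measurable
          exact (Complex.measurable_ofReal.comp (by fun_prop)).aestronglyMeasurable
        -- Substitution of T γ y for y under the invariant measure M, after which D(T γ y) = D(y).
        conv_lhs => rw [← (hT γ).map_eq]
        rw [integral_map (hT γ).measurable.aemeasurable (by rwa [(hT γ).map_eq])]
        refine integral_congr_ae ?_
        filter_upwards [hDT γ] with y hy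
        rw [hy, hpT, inv_smul_smul]
    _ = ∫ y, ∫ γ : Γ, ((u (γ • p y) * v (p y) : ℝ) : ℂ) * D y ∂vol ∂M :=
        integral_integral_swap h2
    _ = ∫ y, (v (p y) : ℂ) * D y ∂M := by
        refine integral_congr_ae (.of_forall fun y => ?_)
        simp only
        rw [integral_mul_const, integral_complex_ofReal, integral_mul_const, hu1, one_mul]

end Averaging

end IDS

namespace IDS

/-! ### Fibers of elements of the direct integral, decomposable operators -/

section Fiber

variable {X K : Type*} [MetricSpace X] [LocallyCompactSpace X] [SecondCountableTopology X]
  [MeasurableSpace X] [BorelSpace X] [TopologicalSpace K] [CompactSpace K] [T2Space K]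

lemma Config.hasSum_integral (ω : Config X K) {F : X → ℂ} (hF : Integrable F ω.pointMeasure) :
    HasSum (fun x : ω.carrier => F x) (∫ x, F x ∂ω.pointMeasure) := by
  have := ω.countable_carrier
  have h := hasSum_integral_measure (μ := fun x : ω.carrier => Measure.dirac (x : X)) hF
  simp only [integral_dirac] at h
  exact h

variable {μ : Measure (Config X K)} [SFinite μ]

lemma ae_integrable_of_integrable {F : Config X K × X → ℂ}
    (hF : Integrable F (fiberMeasure μ)) :
    ∀ᵐ ω ∂μ, Integrable (fun x => F (ω, x)) ω.pointMeasure := by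
  rw [fiberMeasure_eq_compProd] at hF
  exact ((Measure.integrable_compProd_iff hF.1).1 hF).1

open scoped Classical in
/-- The fiber over `ω` of an element of the direct integral. -/
def fiber (f : DirectIntegral μ) (ω : Config X K) : ω.ell2 :=
  if h : ∃ v : ω.ell2, ∀ x : ω.carrier, v x = f (ω, (x : X)) then h.choose else 0

omit [LocallyCompactSpace X] [SecondCountableTopology X] [BorelSpace X] [CompactSpace K]
  [T2Space K] [SFinite μ] in
lemma fiber_eq {f : DirectIntegral μ} {ω : Config X K} {v : ω.ell2}
    (h : ∀ x : ω.carrier, v x = f (ω, (x : X))) : fiber f ω = v := by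
  have hex : ∃ v : ω.ell2, ∀ x : ω.carrier, v x = f (ω, (x : X)) := ⟨v, h⟩
  rw [fiber, dif_pos hex]
  exact lp.ext (funext fun x => (hex.choose_spec x).trans (h x).symm)

/-- By Tonelli ∑ |f(ω, x)|² is finite for almost every ω, so the default value in `fiber` is
confined to a null set. -/
lemma ae_fiber (f : DirectIntegral μ) :
    ∀ᵐ ω ∂μ, ∀ x : ω.carrier, fiber f ω x = f (ω, (x : X)) := by
  have hm : Measurable fun p : Config X K × X => ‖f p‖ₑ ^ (2 : ℝ) :=
    (Lp.stronglyMeasurable f).measurable.enorm.pow_const _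
  have h1 : ∫⁻ p, ‖f p‖ₑ ^ (2 : ℝ) ∂fiberMeasure μ < ∞ := by
    have := lintegral_rpow_enorm_lt_top_of_eLpNorm_lt_top (p := 2) two_ne_zero
      ENNReal.ofNat_ne_top (Lp.memLp f).eLpNorm_lt_top
    simpa using this
  rw [lintegral_fiberMeasure μ hm] at h1
  have hm' : Measurable fun ω : Config X K => ∫⁻ x, ‖f (ω, x)‖ₑ ^ (2 : ℝ) ∂ω.pointMeasure :=
    Measurable.lintegral_kernel_prod_right' (κ := pointKernel X K) hm
  filter_upwards [ae_lt_top hm' h1.ne] with ω hω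
  rw [Config.lintegral_pointMeasure] at hω
  have hmem : Memℓp (fun x : ω.carrier => f (ω, (x : X))) 2 := by
    refine memℓp_gen ?_
    have h2 := ENNReal.summable_toReal hω.ne
    refine h2.congr fun x => ?_
    rw [← ENNReal.toReal_rpow, toReal_enorm]
    simp
  have := fiber_eq (v := (⟨_, hmem⟩ : ω.ell2)) fun x => rfl
  intro x
  rw [this]

lemma fiber_add (f g : DirectIntegral μ) :
    ∀ᵐ ω ∂μ, fiber (f + g) ω = fiber f ω + fiber g ω := by
  filter_upwards [ae_fiber f, ae_fiber g, ae_carrier_of_ae (Lp.coeFn_add f g)] with ω h1 h2 h3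
  refine fiber_eq fun x => ?_
  rw [h3 x x.2, Pi.add_apply, ← h1, ← h2]
  rfl

lemma fiber_smul (c : ℂ) (f : DirectIntegral μ) :
    ∀ᵐ ω ∂μ, fiber (c • f) ω = c • fiber f ω := by
  filter_upwards [ae_fiber f, ae_carrier_of_ae (Lp.coeFn_smul c f)] with ω h1 h3
  refine fiber_eq fun x => ?_
  rw [h3 x x.2, Pi.smul_apply, ← h1]
  rfl

lemma ae_integral_inner (f g : DirectIntegral μ) :
    ∀ᵐ ω ∂μ, ∫ x, inner ℂ (f (ω, x)) (g (ω, x)) ∂ω.pointMeasure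
      = inner ℂ (fiber f ω) (fiber g ω) := by
  have hi := L2.integrable_inner (𝕜 := ℂ) f g
  filter_upwards [ae_fiber f, ae_fiber g, ae_integrable_of_integrable hi] with ω h1 h2 h3
  have h4 := lp.hasSum_inner (𝕜 := ℂ) (fiber f ω) (fiber g ω)
  simp only [h1, h2] at h4
  exact (ω.hasSum_integral h3).unique h4

lemma integrable_inner_fiber (f g : DirectIntegral μ) :
    Integrable (fun ω => inner ℂ (fiber f ω) (fiber g ω)) μ :=
  (integrable_fiber (L2.integrable_inner (𝕜 := ℂ) f g)).congr (ae_integral_inner f g)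

lemma inner_eq_integral (f g : DirectIntegral μ) :
    inner ℂ f g = ∫ ω, inner ℂ (fiber f ω) (fiber g ω) ∂μ := by
  rw [L2.inner_def, integral_fiberMeasure (L2.integrable_inner (𝕜 := ℂ) f g)]
  exact integral_congr_ae (ae_integral_inner f g)

/-- Multiplication by the indicator function of a measurable set of configurations. -/
def cut {A : Set (Config X K)} (hA : MeasurableSet A) (f : DirectIntegral μ) :
    DirectIntegral μ :=
  ((Lp.memLp f).indicator (hA.prod MeasurableSet.univ)).toLp

open scoped Classical in
lemma fiber_cut {A : Set (Config X K)} (hA : MeasurableSet A) (f : DirectIntegral μ) :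
    ∀ᵐ ω ∂μ, fiber (cut hA f) ω = if ω ∈ A then fiber f ω else 0 := by
  have h0 : cut hA f =ᵐ[fiberMeasure μ] (A ×ˢ univ).indicator f := MemLp.coeFn_toLp _
  filter_upwards [ae_fiber f, ae_carrier_of_ae h0] with ω h1 h2
  refine fiber_eq fun x => ?_
  rw [h2 x x.2]
  by_cases hω : ω ∈ A
  · simp [hω, h1]
  · simp [hω]

/-- `A` is the direct integral of the operators `A_ω`. -/
def Decomposes (Af : ∀ ω : Config X K, ω.ell2 →L[ℂ] ω.ell2)
    (A : DirectIntegral μ →L[ℂ] DirectIntegral μ) : Prop :=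
  ∀ f, ∀ᵐ ω ∂μ, fiber (A f) ω = Af ω (fiber f ω)

namespace Decomposes

variable {Af Bf : ∀ ω : Config X K, ω.ell2 →L[ℂ] ω.ell2}
  {A B : DirectIntegral μ →L[ℂ] DirectIntegral μ}

lemma congr (h : Decomposes Af A) (h' : ∀ᵐ ω ∂μ, Af ω = Bf ω) : Decomposes Bf A := fun f => by
  filter_upwards [h f, h'] with ω h1 h2
  rw [h1, h2]

lemma const (c : ℂ) : Decomposes (μ := μ) (fun _ => algebraMap ℂ _ c)
    (algebraMap ℂ _ c) := fun f => by
  filter_upwards [fiber_smul c f] with ω h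
  simpa [Algebra.algebraMap_eq_smul_one] using h

lemma add (hA : Decomposes Af A) (hB : Decomposes Bf B) :
    Decomposes (fun ω => Af ω + Bf ω) (A + B) := fun f => by
  filter_upwards [hA f, hB f, fiber_add (A f) (B f)] with ω h1 h2 h3
  rw [_root_.add_apply, _root_.add_apply, h3, h1, h2]

lemma mul (hA : Decomposes Af A) (hB : Decomposes Bf B) :
    Decomposes (fun ω => Af ω * Bf ω) (A * B) := fun f => by
  filter_upwards [hA (B f), hB f] with ω h1 h2
  rw [mul_apply_eq_comp, mul_apply_eq_comp, h1, h2]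

/-- Norm convergence of `An n f` gives almost everywhere convergence along a subsequence. In the
fibers, convergence of operators gives convergence of each coordinate, and the two limits agree. -/
lemma of_tendsto {Afn : ℕ → ∀ ω : Config X K, ω.ell2 →L[ℂ] ω.ell2}
    {An : ℕ → DirectIntegral μ →L[ℂ] DirectIntegral μ} (h : ∀ n, Decomposes (Afn n) (An n))
    (hf : ∀ ω, Tendsto (fun n => Afn n ω) atTop (𝓝 (Af ω))) (hA : Tendsto An atTop (𝓝 A)) :
    Decomposes Af A := fun f => by
  have h1 : Tendsto (fun n => An n f) atTop (𝓝 (A f)) :=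
    ((ContinuousLinearMap.apply ℂ _ f).continuous.tendsto A).comp hA
  obtain ⟨ns, hns, hae⟩ := (tendstoInMeasure_of_tendsto_Lp h1).exists_seq_tendsto_ae
  have hall : ∀ᵐ ω ∂μ, ∀ n, fiber (An n f) ω = Afn n ω (fiber f ω) := ae_all_iff.2 fun n => h n f
  have hall' : ∀ᵐ ω ∂μ, ∀ n, ∀ x : ω.carrier, fiber (An n f) ω x = An n f (ω, (x : X)) :=
    ae_all_iff.2 fun n => ae_fiber (An n f)
  filter_upwards [ae_carrier_of_ae hae, hall, hall'] with ω h2 h3 h4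
  refine fiber_eq fun x => ?_
  refine tendsto_nhds_unique ?_ (h2 x x.2)
  have h5 : Tendsto (fun n => Afn n ω (fiber f ω)) atTop (𝓝 (Af ω (fiber f ω))) :=
    ((ContinuousLinearMap.apply ℂ _ (fiber f ω)).continuous.tendsto (Af ω)).comp (hf ω)
  have h6 : Tendsto (fun n => (Afn n ω (fiber f ω) : ω.carrier → ℂ) x) atTop
      (𝓝 ((Af ω (fiber f ω) : ω.carrier → ℂ) x)) :=
    ((lp.evalCLM ℂ (fun _ : ω.carrier => ℂ) (p := 2) x).continuous.tendsto _).comp h5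
  refine (h6.comp hns.tendsto_atTop).congr fun n => ?_
  simp only [Function.comp_apply]
  rw [← h3, h4]

/-- The fibers of a selfadjoint decomposable operator are symmetric on the fibers of elements of
the direct integral. -/
lemma ae_symm (h : Decomposes Af A) (hA : IsSelfAdjoint A) (f g : DirectIntegral μ) :
    ∀ᵐ ω ∂μ, inner ℂ (fiber f ω) (Af ω (fiber g ω)) = inner ℂ (Af ω (fiber f ω)) (fiber g ω) := by
  have key : (fun ω => inner ℂ (fiber f ω) (fiber (A g) ω)) =ᵐ[μ]
      fun ω => inner ℂ (fiber (A f) ω) (fiber g ω) := by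
    refine Integrable.ae_eq_of_forall_setIntegral_eq _ _ (integrable_inner_fiber _ _)
      (integrable_inner_fiber _ _) fun S hS _ => ?_
    -- Cutting by S commutes with a fiberwise operator, so symmetry of A tested on the cut vector
    -- compares the integrals over S of the two fiber inner products.
    have hsym : inner ℂ (cut hS f) (A g) = inner ℂ (A (cut hS f)) g := by
      conv_rhs => rw [← hA.adjoint_eq, ContinuousLinearMap.adjoint_inner_left]
    rw [inner_eq_integral, inner_eq_integral] at hsym
    rw [← integral_indicator hS, ← integral_indicator hS]
    refine (integral_congr_ae ?_).trans (hsym.trans (integral_congr_ae ?_))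
    · filter_upwards [fiber_cut hS f] with ω h1
      rw [h1]
      by_cases hω : ω ∈ S <;> simp [hω]
    · filter_upwards [fiber_cut hS f, h (cut hS f), h f] with ω h1 h2 h3
      rw [h2, h1]
      by_cases hω : ω ∈ S <;> simp [hω, h3]
  filter_upwards [key, h f, h g] with ω h1 h2 h3
  rw [← h2, ← h3, h1]

end Decomposes

end Fiber

end IDS

namespace IDS

/-! ### The functional calculus of a decomposable operator -/

section Basis

variable {X K : Type*} [MetricSpace X]

open scoped Classical in
/-- The basis vector `δ_x` of `ℓ²(X(ω))`. -/
def Config.basis (ω : Config X K) (x : ω.carrier) : ω.ell2 := lp.single 2 x (1 : ℂ)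

lemma Config.entry_eq_basis (ω : Config X K) (T : ω.ell2 →L[ℂ] ω.ell2) (x y : ω.carrier) :
    ω.entry T x y = (T (ω.basis y) : ω.carrier → ℂ) x := rfl

lemma Config.inner_basis (ω : Config X K) (x : ω.carrier) (v : ω.ell2) :
    inner ℂ (ω.basis x) v = v x := by
  classical
  rw [Config.basis, lp.inner_single_left]
  simp

lemma Config.norm_basis (ω : Config X K) (x : ω.carrier) : ‖ω.basis x‖ = 1 := by
  classical
  rw [Config.basis, lp.norm_single (by norm_num)]
  simp

lemma Config.basis_apply_self (ω : Config X K) (x : ω.carrier) : ω.basis x x = (1 : ℂ) := by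
  classical
  exact lp.single_apply_self _ _ _

lemma Config.basis_apply_ne (ω : Config X K) {x y : ω.carrier} (h : y ≠ x) :
    ω.basis x y = (0 : ℂ) := by
  classical
  exact lp.single_apply_ne _ _ _ h

lemma Config.norm_entry_le (ω : Config X K) (T : ω.ell2 →L[ℂ] ω.ell2) (x y : ω.carrier) :
    ‖ω.entry T x y‖ ≤ ‖T‖ := by
  rw [Config.entry_eq_basis]
  refine (lp.norm_apply_le_norm (by norm_num) _ x).trans ((T.le_opNorm _).trans ?_)
  rw [ω.norm_basis, mul_one]

lemma Config.ell2_ext (ω : Config X K) {W : Type*} [NormedAddCommGroup W] [NormedSpace ℂ W]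
    {S T : ω.ell2 →L[ℂ] W} (h : ∀ x, S (ω.basis x) = T (ω.basis x)) : S = T := by
  classical
  refine lp.ext_continuousLinearMap (by norm_num) fun x => ?_
  ext
  exact h x

lemma Config.isSelfAdjoint_of_basis (ω : Config X K) {T : ω.ell2 →L[ℂ] ω.ell2}
    (h : ∀ x y, inner ℂ (ω.basis x) (T (ω.basis y)) = inner ℂ (T (ω.basis x)) (ω.basis y)) :
    IsSelfAdjoint T := by
  rw [ContinuousLinearMap.isSelfAdjoint_iff']
  refine ω.ell2_ext fun y => lp.ext (funext fun x => ?_)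
  rw [← ω.inner_basis, ← ω.inner_basis, ContinuousLinearMap.adjoint_inner_right, h]

end Basis

section Calculus

variable {X K : Type*} [MetricSpace X] [LocallyCompactSpace X] [SecondCountableTopology X]
  [MeasurableSpace X] [BorelSpace X] [TopologicalSpace K] [CompactSpace K] [T2Space K]

lemma exists_index (X : Type*) [MetricSpace X] [SecondCountableTopology X]
    [LocallyCompactSpace X] [MeasurableSpace X] [BorelSpace X] :
    ∃ n : X → ℕ, Measurable n ∧ ∀ i, IsSmall (n ⁻¹' {i}) := by
  obtain ⟨Q, U, hQm, hQd, hQ, hQU, hU⟩ := exists_partition_isSmall X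
  have h : ∀ x, ∃ i, x ∈ Q i := fun x => mem_iUnion.1 (hQ ▸ mem_univ x)
  choose n hn using h
  have hpre : ∀ i, n ⁻¹' {i} = Q i := by
    intro i
    ext x
    refine ⟨fun hx => hx ▸ hn x, fun hx => ?_⟩
    by_contra hne
    exact (hQd hne).le_bot ⟨hn x, hx⟩
  refine ⟨n, measurable_to_countable' fun i => (hpre i).symm ▸ hQm i, fun i => ?_⟩
  rw [hpre]
  exact (hU i).2.1.mono (hQU i)

variable (μ : Measure (Config X K))

open scoped Classical in
/-- The indicator function of a set of pairs, as an element of the direct integral. -/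
def indVec (S : Set (Config X K × X)) : DirectIntegral μ :=
  if h : MeasurableSet S ∧ fiberMeasure μ S ≠ ∞ then indicatorConstLp 2 h.1 h.2 1 else 0

variable {μ}

lemma indVec_eq {S : Set (Config X K × X)} (hS : MeasurableSet S)
    (hfin : fiberMeasure μ S ≠ ∞) : indVec μ S = indicatorConstLp 2 hS hfin 1 := by
  rw [indVec, dif_pos ⟨hS, hfin⟩]

lemma coeFn_indVec {S : Set (Config X K × X)} (hS : MeasurableSet S)
    (hfin : fiberMeasure μ S ≠ ∞) : indVec μ S =ᵐ[fiberMeasure μ] S.indicator 1 := by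
  rw [indVec_eq hS hfin]
  exact indicatorConstLp_coeFn

variable [IsProbabilityMeasure μ]

lemma fiberMeasure_le_intensity {S : Set (Config X K × X)} {P : Set X} (hP : MeasurableSet P)
    (hSP : S ⊆ Prod.snd ⁻¹' P) : fiberMeasure μ S ≤ intensity μ P := by
  rw [← map_snd_fiberMeasure μ, Measure.map_apply measurable_snd hP]
  exact measure_mono hSP

lemma fiberMeasure_ne_top {S : Set (Config X K × X)} {P : Set X} (hP : MeasurableSet P)
    (hPs : IsSmall P) (hSP : S ⊆ Prod.snd ⁻¹' P) : fiberMeasure μ S ≠ ∞ :=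
  ((fiberMeasure_le_intensity hP hSP).trans (intensity_le_one μ hPs hP)).trans_lt
    ENNReal.one_lt_top |>.ne

lemma fiber_indVec {S : Set (Config X K × X)} (hS : MeasurableSet S) {P : Set X}
    (hP : MeasurableSet P) (hPs : IsSmall P) (hSP : S ⊆ Prod.snd ⁻¹' P) :
    ∀ᵐ ω ∂μ, (∀ x : ω.carrier, (x : X) ∈ P →
        fiber (indVec μ S) ω = (S.indicator 1 (ω, (x : X)) : ℂ) • ω.basis x) ∧
      ((∀ x ∈ ω.carrier, x ∉ P) → fiber (indVec μ S) ω = 0) := by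
  filter_upwards [ae_carrier_of_ae (coeFn_indVec hS (fiberMeasure_ne_top (μ := μ) hP hPs hSP))]
    with ω h
  refine ⟨fun x hx => fiber_eq fun y => ?_, fun hno => fiber_eq fun y => ?_⟩
  · rw [h y y.2, lp.coeFn_smul, Pi.smul_apply]
    by_cases hyx : y = x
    · rw [hyx, ω.basis_apply_self, smul_eq_mul, mul_one]
    · rw [ω.basis_apply_ne hyx, smul_zero, indicator_of_notMem]
      exact fun hy => hyx (Subtype.ext (hPs.eq y.2 x.2 (hSP hy) hx))
  · rw [h y y.2, indicator_of_notMem]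
    · rfl
    · exact fun hy => hno y y.2 (hSP hy)

/-- For a partition into small sets, the indicator functions of its sets have as fibers all basis
vectors. -/
lemma fiber_indVec_index {n : X → ℕ} (hn : Measurable n) (hs : ∀ i, IsSmall (n ⁻¹' {i})) :
    ∀ᵐ ω ∂μ, ∀ x : ω.carrier,
      fiber (indVec μ (Prod.snd ⁻¹' (n ⁻¹' {n x}))) ω = ω.basis x := by
  have h : ∀ᵐ ω ∂μ, ∀ i, ∀ x : ω.carrier, (x : X) ∈ n ⁻¹' {i} →
      fiber (indVec μ (Prod.snd ⁻¹' (n ⁻¹' {i}))) ω = ω.basis x := by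
    refine ae_all_iff.2 fun i => ?_
    have hm : MeasurableSet (n ⁻¹' {i}) := hn (measurableSet_singleton i)
    filter_upwards [fiber_indVec (measurable_snd hm) hm (hs i) Subset.rfl] with ω hω x hx
    rw [hω.1 x hx, indicator_of_mem (show (ω, (x : X)) ∈ Prod.snd ⁻¹' (n ⁻¹' {i}) from hx)]
    simp
  filter_upwards [h] with ω hω x
  exact hω (n x) x rfl

namespace Decomposes

variable {Af : ∀ ω : Config X K, ω.ell2 →L[ℂ] ω.ell2}
  {A : DirectIntegral μ →L[ℂ] DirectIntegral μ}

/-- Symmetry holds off a null set that depends on the two vectors. Countably many indicator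
functions suffice to produce all basis vectors of almost every fiber, so a single null set does. -/
lemma ae_isSelfAdjoint (h : Decomposes Af A) (hA : IsSelfAdjoint A) :
    ∀ᵐ ω ∂μ, IsSelfAdjoint (Af ω) := by
  obtain ⟨n, hn, hs⟩ := exists_index X
  have hall : ∀ᵐ ω ∂μ, ∀ i j, inner ℂ (fiber (indVec μ (Prod.snd ⁻¹' (n ⁻¹' {i}))) ω)
      (Af ω (fiber (indVec μ (Prod.snd ⁻¹' (n ⁻¹' {j}))) ω)) =
      inner ℂ (Af ω (fiber (indVec μ (Prod.snd ⁻¹' (n ⁻¹' {i}))) ω))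
        (fiber (indVec μ (Prod.snd ⁻¹' (n ⁻¹' {j}))) ω) :=
    ae_all_iff.2 fun i => ae_all_iff.2 fun j => h.ae_symm hA _ _
  filter_upwards [hall, fiber_indVec_index hn hs] with ω h1 h2
  refine ω.isSelfAdjoint_of_basis fun x y => ?_
  have := h1 (n x) (n y)
  rwa [h2, h2] at this

/-- The diagonal matrix elements of a decomposable operator form a measurable function. -/
lemma exists_diagonal (h : Decomposes Af A) :
    ∃ D : Config X K × X → ℂ, Measurable D ∧
      ∀ᵐ ω ∂μ, ∀ x : ω.carrier, D (ω, (x : X)) = ω.entry (Af ω) x x := by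
  obtain ⟨n, hn, hs⟩ := exists_index X
  obtain ⟨G, hGm, hG⟩ : ∃ G : ℕ → Config X K × X → ℂ, (∀ i, Measurable (G i)) ∧
      ∀ i p, G i p = A (indVec μ (Prod.snd ⁻¹' (n ⁻¹' {i}))) p :=
    ⟨fun i => A (indVec μ (Prod.snd ⁻¹' (n ⁻¹' {i}))),
      fun i => (Lp.stronglyMeasurable _).measurable, fun i p => rfl⟩
  have hGm' : Measurable fun q : ℕ × (Config X K × X) => G q.1 q.2 :=
    measurable_from_prod_countable_right hGm
  -- In the fiber over ω, the indicator of the piece that contains x is δ_x; the value at x of its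
  -- image is the diagonal matrix element.
  refine ⟨fun p => G (n p.2) p, hGm'.comp ((hn.comp measurable_snd).prodMk measurable_id), ?_⟩
  have hall : ∀ᵐ ω ∂μ, ∀ i, fiber (A (indVec μ (Prod.snd ⁻¹' (n ⁻¹' {i})))) ω =
      Af ω (fiber (indVec μ (Prod.snd ⁻¹' (n ⁻¹' {i}))) ω) := ae_all_iff.2 fun i => h _
  have hall' : ∀ᵐ ω ∂μ, ∀ i, ∀ x : ω.carrier,
      fiber (A (indVec μ (Prod.snd ⁻¹' (n ⁻¹' {i})))) ω x = G i (ω, (x : X)) := by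
    simp only [hG]
    exact ae_all_iff.2 fun i => ae_fiber _
  filter_upwards [hall, hall', fiber_indVec_index hn hs] with ω h1 h2 h3 x
  rw [← h2 (n x) x, h1, h3, ω.entry_eq_basis]

/-- Stone–Weierstrass on one disc that contains the spectra of A and of all fibers: the statement
holds for constants, z and z̄, and survives sums, products and uniform limits. -/
lemma discHom {r : ℝ} (h : Decomposes Af A) (hA : IsSelfAdjoint A) (hAr : ‖A‖ ≤ r)
    (hs : ∀ ω, IsSelfAdjoint (Af ω)) (hr : ∀ ω, ‖Af ω‖ ≤ r)
    (g : C(Metric.closedBall (0 : ℂ) r, ℂ)) :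
    Decomposes (fun ω => IDS.discHom (hs ω) (hr ω) g) (IDS.discHom hA hAr g) := by
  induction g using ContinuousMap.induction_on_of_compact with
  | const c =>
    have hc : ContinuousMap.const (Metric.closedBall (0 : ℂ) r) c
        = algebraMap ℂ C(Metric.closedBall (0 : ℂ) r, ℂ) c := rfl
    simp only [hc, AlgHomClass.commutes]
    exact Decomposes.const c
  | id =>
    simp only [discHom_id]
    exact h
  | star_id =>
    simp only [map_star, discHom_id, hA.star_eq, fun ω => (hs ω).star_eq]
    exact h
  | add f g hf hg =>
    simp only [map_add]
    exact hf.add hg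
  | mul f g hf hg =>
    simp only [map_mul]
    exact hf.mul hg
  | frequently f hf =>
    obtain ⟨u, hu, hlim⟩ := mem_closure_iff_seq_limit.1 (mem_closure_iff_frequently.2 hf)
    refine Decomposes.of_tendsto (Afn := fun k ω => IDS.discHom (hs ω) (hr ω) (u k))
      (An := fun k => IDS.discHom hA hAr (u k)) hu (fun ω => ?_) ?_
    · exact ((cfcHomSuperset_continuous _ _).tendsto f).comp hlim
    · exact ((cfcHomSuperset_continuous _ _).tendsto f).comp hlim

/-- The functional calculus of a selfadjoint decomposable operator is taken fiberwise. -/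
theorem cfc (h : Decomposes Af A) (hA : IsSelfAdjoint A) {C : ℝ} (hC : ∀ᵐ ω ∂μ, ‖Af ω‖ ≤ C)
    (g : C(ℂ, ℂ)) : Decomposes (fun ω => _root_.cfc g (Af ω)) (_root_.cfc g A) := by
  classical
  -- The calculus on the disc needs selfadjoint fibers of norm at most r for every ω, so the
  -- exceptional fibers are replaced by zero. The entry 0 in r covers these, `‖A‖` covers the
  -- operator itself.
  let r := max (max C 0) ‖A‖
  let Bf : ∀ ω : Config X K, ω.ell2 →L[ℂ] ω.ell2 := fun ω =>
    if IsSelfAdjoint (Af ω) ∧ ‖Af ω‖ ≤ C then Af ω else 0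
  have hBs : ∀ ω, IsSelfAdjoint (Bf ω) := fun ω => by
    by_cases hω : IsSelfAdjoint (Af ω) ∧ ‖Af ω‖ ≤ C
    · simp only [Bf, if_pos hω, hω.1]
    · simp only [Bf, if_neg hω, IsSelfAdjoint.zero]
  have hBr : ∀ ω, ‖Bf ω‖ ≤ r := fun ω => by
    by_cases hω : IsSelfAdjoint (Af ω) ∧ ‖Af ω‖ ≤ C
    · simp only [Bf, if_pos hω]
      exact hω.2.trans ((le_max_left _ _).trans (le_max_left _ _))
    · simp only [Bf, if_neg hω, norm_zero]
      exact (le_max_right _ _).trans (le_max_left _ _)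
  have hae : ∀ᵐ ω ∂μ, Af ω = Bf ω := by
    filter_upwards [h.ae_isSelfAdjoint hA, hC] with ω h1 h2
    simp only [Bf, if_pos (And.intro h1 h2)]
  have key := (h.congr hae).discHom hA (le_max_right _ _) hBs hBr (g.restrict _)
  simp only [discHom_restrict] at key
  refine key.congr ?_
  filter_upwards [hae] with ω hω
  rw [hω]

end Decomposes

end Calculus

end IDS

namespace IDS

/-! ### Equivariance of the diagonal matrix elements -/

section Equivariance

variable {X K Γ : Type*} [MetricSpace X] [Group Γ] [MulAction Γ X] [IsIsometricSMul Γ X]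

lemma Config.basis_smulPoint_apply (γ : Γ) (ω : Config X K) (x y : ω.carrier) :
    (γ • ω).basis (ω.smulPoint γ x) (ω.smulPoint γ y) = ω.basis x y := by
  by_cases h : y = x
  · rw [h, Config.basis_apply_self, Config.basis_apply_self]
  · rw [ω.basis_apply_ne h, Config.basis_apply_ne]
    exact fun h' => h ((ω.smulEquiv γ).injective h')

/-- The twisted basis of `ℓ²(X(γ ω))`, indexed by `X(ω)`. -/
lemma Config.exists_hilbertBasis (γ : Γ) (ω : Config X K) {c : X → ℂ} (hc : ∀ x, ‖c x‖ = 1) :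
    ∃ b : HilbertBasis ω.carrier ℂ (γ • ω).ell2,
      ∀ x, b x = conj (c x) • (γ • ω).basis (ω.smulPoint γ x) := by
  let v : ω.carrier → (γ • ω).ell2 := fun x => conj (c x) • (γ • ω).basis (ω.smulPoint γ x)
  have hcc : ∀ x, c x * conj (c x) = 1 := fun x => by
    rw [Complex.mul_conj, Complex.normSq_eq_norm_sq, hc]
    norm_num
  have hv : Orthonormal ℂ v := by
    refine ⟨fun x => ?_, fun x y hxy => ?_⟩
    · rw [norm_smul, Config.norm_basis, RCLike.norm_conj, hc, mul_one]
    · change inner ℂ (v x) (v y) = 0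
      rw [inner_smul_left, inner_smul_right, Config.inner_basis, Config.basis_smulPoint_apply,
        ω.basis_apply_ne hxy]
      simp
  have hsp : (Submodule.span ℂ (range v))ᗮ = ⊥ := by
    rw [Submodule.eq_bot_iff]
    intro w hw
    refine lp.ext (funext fun y => ?_)
    obtain ⟨x, rfl⟩ := (ω.smulEquiv γ).surjective y
    have h := (Submodule.mem_orthogonal _ _).1 hw _ (Submodule.subset_span (mem_range_self x))
    rw [inner_smul_left, Config.inner_basis, Complex.conj_conj] at h
    exact (mul_eq_zero.1 h).resolve_left fun h0 => by
      have := hc x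
      rw [h0, norm_zero] at this
      exact zero_ne_one this
  refine ⟨HilbertBasis.mkOfOrthogonalEqBot hv hsp, fun x => ?_⟩
  rw [HilbertBasis.coe_mkOfOrthogonalEqBot]

/-- The functional calculus of unitarily equivalent operators. -/
lemma Config.entry_cfc_smul {γ : Γ} {ω : Config X K} {c : X → ℂ} (hc : ∀ x, ‖c x‖ = 1)
    {T : ω.ell2 →L[ℂ] ω.ell2} {T' : (γ • ω).ell2 →L[ℂ] (γ • ω).ell2}
    (h : ∀ x y : ω.carrier, c x * (γ • ω).entry T' (ω.smulPoint γ x) (ω.smulPoint γ y) *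
      conj (c y) = ω.entry T x y)
    (hT : IsSelfAdjoint T) (hT' : IsSelfAdjoint T') {g : ℂ → ℂ} (hg : Continuous g)
    (x : ω.carrier) :
    (γ • ω).entry (cfc g T') (ω.smulPoint γ x) (ω.smulPoint γ x) = ω.entry (cfc g T) x x := by
  classical
  obtain ⟨b, hb⟩ := ω.exists_hilbertBasis γ hc
  have hrepr : ∀ y, b.repr (b y) = ω.basis y := fun y => by
    rw [b.repr_self]
    rfl
  -- Conjugation by the twisted unitary multiplies the matrix by phases. By equivariance it carries
  -- T' to T, hence g(T') to g(T), and on the diagonal the phases cancel.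
  have hentry : ∀ (S : (γ • ω).ell2 →L[ℂ] (γ • ω).ell2) (x y : ω.carrier),
      ω.entry (b.repr.conjStarAlgEquiv S) x y =
        c x * (γ • ω).entry S (ω.smulPoint γ x) (ω.smulPoint γ y) * conj (c y) := by
    intro S x y
    rw [ω.entry_eq_basis, LinearIsometryEquiv.conjStarAlgEquiv_apply_apply, ← hrepr y,
      LinearIsometryEquiv.symm_apply_apply, b.repr_apply_apply, hb, hb, map_smul, inner_smul_left,
      inner_smul_right, Config.inner_basis, Complex.conj_conj, ← Config.entry_eq_basis]
    ring
  have hconj : b.repr.conjStarAlgEquiv T' = T := by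
    refine ω.ell2_ext fun y => lp.ext (funext fun x => ?_)
    rw [← ω.entry_eq_basis, ← ω.entry_eq_basis, hentry, h]
  have hcont : Continuous b.repr.conjStarAlgEquiv := by
    change Continuous fun S : (γ • ω).ell2 →L[ℂ] (γ • ω).ell2 => b.repr.conjStarAlgEquiv S
    simp only [LinearIsometryEquiv.conjStarAlgEquiv_apply]
    fun_prop
  have := hT.isStarNormal
  have := hT'.isStarNormal
  have hmap := StarAlgHomClass.map_cfc (S := ℂ) b.repr.conjStarAlgEquiv g T' hg.continuousOn
    hcont ‹_› (by rw [hconj]; assumption)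
  rw [hconj] at hmap
  rw [← hmap, hentry]
  have : c x * conj (c x) = 1 := by
    rw [Complex.mul_conj, Complex.normSq_eq_norm_sq, hc]
    norm_num
  rw [mul_right_comm, this, one_mul]

end Equivariance

/-! ### The trace per unit volume -/

section Trace

variable {X K Γ : Type*} [MetricSpace X] [LocallyCompactSpace X] [SecondCountableTopology X]
  [MeasurableSpace X] [BorelSpace X] [TopologicalSpace K] [CompactSpace K] [T2Space K]

lemma ae_fiberMeasure_of_ae {μ : Measure (Config X K)} [SFinite μ]
    {p : Config X K × X → Prop} (hp : MeasurableSet {z | p z})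
    (h : ∀ᵐ ω ∂μ, ∀ x ∈ ω.carrier, p (ω, x)) : ∀ᵐ z ∂fiberMeasure μ, p z := by
  rw [fiberMeasure_eq_compProd, Measure.ae_compProd_iff hp]
  filter_upwards [h] with ω hω
  exact ω.ae_pointMeasure_iff.2 hω

/-- `D` is the function `(ω, x) ↦ φ(H_ω)(x, x)`. -/
structure IsDiagonal (μ : Measure (Config X K))
    (Hf : ∀ ω : Config X K, ω.ell2 →L[ℂ] ω.ell2) (φ : C_c(ℝ, ℂ)) (D : Config X K × X → ℂ) :
    Prop where
  measurable : Measurable D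
  ae_eq : ∀ᵐ ω ∂μ, ∀ x : ω.carrier,
    D (ω, (x : X)) = ω.entry (cfc (fun z : ℂ => φ z.re) (Hf ω)) x x

variable {μ : Measure (Config X K)} {Hf : ∀ ω : Config X K, ω.ell2 →L[ℂ] ω.ell2}
  {φ : C_c(ℝ, ℂ)} {D : Config X K × X → ℂ}

lemma IsDiagonal.exists_bound [SFinite μ] (hD : IsDiagonal μ Hf φ D) :
    ∃ C, ∀ᵐ p ∂fiberMeasure μ, ‖D p‖ ≤ C := by
  obtain ⟨C, hC⟩ := φ.hasCompactSupport.exists_bound_of_continuous φ.continuous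
  refine ⟨C, ae_fiberMeasure_of_ae (hD.measurable.norm measurableSet_Iic) ?_⟩
  filter_upwards [hD.ae_eq] with ω h x hx
  rw [h ⟨x, hx⟩]
  exact (ω.norm_entry_le _ _ _).trans
    (norm_cfc_le ((norm_nonneg _).trans (hC 0)) fun z _ => hC _)

lemma IsDiagonal.integrable [SFinite μ] (hD : IsDiagonal μ Hf φ D) {u : X → ℝ}
    (hu : Integrable u (intensity μ)) :
    Integrable (fun p : Config X K × X => (u p.2 : ℂ) * D p) (fiberMeasure μ) := by
  obtain ⟨C, hC⟩ := hD.exists_bound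
  exact (((measurePreserving_snd μ).integrable_comp_of_integrable hu).ofReal).mul_bdd (c := C)
    hD.measurable.aestronglyMeasurable hC

lemma IsDiagonal.ae_traceFun [SFinite μ] (hD : IsDiagonal μ Hf φ D) {u : X → ℝ}
    (hu : Integrable u (intensity μ)) :
    (fun ω => ∫ x, (u x : ℂ) * D (ω, x) ∂ω.pointMeasure) =ᵐ[μ] traceFun Hf u φ := by
  filter_upwards [hD.ae_eq, ae_integrable_of_integrable (hD.integrable hu)] with ω h1 h2
  rw [← (ω.hasSum_integral h2).tsum_eq, traceFun, Config.trace]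
  exact tsum_congr fun x => by rw [h1]

lemma IsDiagonal.integrable_traceFun [SFinite μ] (hD : IsDiagonal μ Hf φ D) {u : X → ℝ}
    (hu : Integrable u (intensity μ)) : Integrable (traceFun Hf u φ) μ :=
  (integrable_fiber (hD.integrable hu)).congr (hD.ae_traceFun hu)

lemma IsDiagonal.integral_traceFun [SFinite μ] (hD : IsDiagonal μ Hf φ D) {u : X → ℝ}
    (hu : Integrable u (intensity μ)) :
    ∫ ω, traceFun Hf u φ ω ∂μ = ∫ p, (u p.2 : ℂ) * D p ∂fiberMeasure μ := by
  rw [integral_fiberMeasure (hD.integrable hu)]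
  exact (integral_congr_ae (hD.ae_traceFun hu)).symm

section ConditionA

variable [Group Γ] [MulAction Γ X] [IsIsometricSMul Γ X] {ι : ℂ → K} {s : Γ → X → Circle}
  {H : DirectIntegral μ →L[ℂ] DirectIntegral μ}

lemma ConditionA.decomposes (hH : ConditionA ι μ s Hf H) : Decomposes Hf H := fun f => by
  filter_upwards [hH.decomposable f] with ω ⟨v, h1, h2⟩
  rw [fiber_eq h1]
  exact fiber_eq fun x => (h2 x).symm

/-- The function `z ↦ φ (re z)`. -/
def reComp (φ : C_c(ℝ, ℂ)) : C(ℂ, ℂ) := ⟨fun z => φ z.re, by fun_prop⟩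

variable [IsProbabilityMeasure μ] [μ.Regular]

/-- The bound on the fibers is known on the support only, which has full measure because μ is
regular. -/
lemma ConditionA.decomposes_cfc (hH : ConditionA ι μ s Hf H) (φ : C_c(ℝ, ℂ)) :
    Decomposes (fun ω => cfc (fun z : ℂ => φ z.re) (Hf ω)) (cfc (fun z : ℂ => φ z.re) H) := by
  obtain ⟨C, hC⟩ := hH.bounded
  have hC' : ∀ᵐ ω ∂μ, ‖Hf ω‖ ≤ C := by
    filter_upwards [Measure.support_mem_ae_of_regular] with ω hω using hC ω hω
  exact hH.decomposes.cfc hH.selfAdjoint hC' (reComp φ)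

lemma ConditionA.exists_isDiagonal (hH : ConditionA ι μ s Hf H) (φ : C_c(ℝ, ℂ)) :
    ∃ D, IsDiagonal μ Hf φ D := by
  obtain ⟨D, h1, h2⟩ := (hH.decomposes_cfc φ).exists_diagonal
  exact ⟨D, h1, h2⟩

/-- H_ω and H_γω are unitarily equivalent through phases and translation. As γ preserves μ, both are
selfadjoint and both have D as diagonal for almost every ω. -/
lemma ConditionA.ae_pairSMul (hH : ConditionA ι μ s Hf H)
    (hμ : ∀ γ : Γ, MeasurePreserving (fun ω : Config X K => γ • ω) μ μ)
    (hD : IsDiagonal μ Hf φ D) (γ : Γ) :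
    ∀ᵐ p ∂fiberMeasure μ, D (pairSMul γ p) = D p := by
  refine ae_fiberMeasure_of_ae (measurableSet_eq_fun
    (hD.measurable.comp (measurePreserving_pairSMul (hμ γ)).measurable) hD.measurable) ?_
  have hsa := hH.decomposes.ae_isSelfAdjoint hH.selfAdjoint
  filter_upwards [hD.ae_eq, (hμ γ).quasiMeasurePreserving.ae hD.ae_eq, hsa,
    (hμ γ).quasiMeasurePreserving.ae hsa, Measure.support_mem_ae_of_regular]
    with ω h1 h2 h3 h4 h5 x hx
  refine (h2 (ω.smulPoint γ ⟨x, hx⟩)).trans ((Config.entry_cfc_smul (c := fun x => s γ x)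
    (fun x => Circle.norm_coe _) (hH.equivariant γ ω h5) h3 h4 (reComp φ).continuous _).trans
    (h1 ⟨x, hx⟩).symm)

end ConditionA

end Trace

/-! ### Admissible weights -/

section Admissible

lemma lintegral_ofReal_eq_one {Γ : Type*} [MeasurableSpace Γ] {vol : Measure Γ} {f : Γ → ℝ}
    (hf : ∀ γ, 0 ≤ f γ) (h : ∫ γ, f γ ∂vol = 1) : ∫⁻ γ, ENNReal.ofReal (f γ) ∂vol = 1 := by
  have hi : Integrable f vol := by
    by_contra hi
    rw [integral_undef hi] at h
    exact zero_ne_one h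
  rw [← ofReal_integral_eq_lintegral_ofReal hi (.of_forall hf), h, ENNReal.ofReal_one]

variable {X K Γ : Type*} [MetricSpace X] [LocallyCompactSpace X] [SecondCountableTopology X]
  [MeasurableSpace X] [BorelSpace X] [TopologicalSpace K] [CompactSpace K] [T2Space K]
  [Group Γ] [MetricSpace Γ] [IsTopologicalGroup Γ] [ProperSpace Γ] [IsIsometricSMul Γ Γ]
  [MeasurableSpace Γ] [BorelSpace Γ] [MulAction Γ X] [ContinuousSMul Γ X] [IsIsometricSMul Γ X]
  {vol : Measure Γ} [vol.IsHaarMeasure] [vol.IsMulRightInvariant] {F' : Set X}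
  {μ : Measure (Config X K)} [IsProbabilityMeasure μ] {u : X → ℝ}

lemma IsAdmissible.integral_smul_eq_one (hu : IsAdmissible vol μ u) (x : X) :
    ∫ γ : Γ, u (γ • x) ∂vol = 1 := by
  have := isInvInvariant_of_unimodular vol
  rw [← hu.integral_eq_one x, ← integral_inv_eq_self (fun γ : Γ => u (γ⁻¹ • x)) vol]
  simp only [inv_inv]

lemma IsRoughFundamentalDomain.integral_weight_inv (hF : IsRoughFundamentalDomain Γ F') (x : X) :
    ∫ γ : Γ, weight vol F' (γ⁻¹ • x) ∂vol = 1 := by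
  have := isInvInvariant_of_unimodular vol
  rw [integral_inv_eq_self (fun γ : Γ => weight vol F' (γ • x)) vol,
    hF.integral_weight vol]

lemma IsRoughFundamentalDomain.integrable_weight (hF : IsRoughFundamentalDomain Γ F') :
    Integrable (weight vol F') (intensity μ) :=
  ((integrable_indicator_iff (hF.measurableSet_smul measurableSet_closedBall)).2
    (integrableOn_const (hF.measure_smul_lt_top _ (isCompact_closedBall _ _)).ne)).const_mul _

/-- For nonnegative u the averaging inequality, in [0, ∞], bounds ∫ u dm by the integral of the
weight on B F', which is finite. -/
lemma IsAdmissible.integrable (hF : IsRoughFundamentalDomain Γ F')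
    (hμ : ∀ γ : Γ, MeasurePreserving (fun ω : Config X K => γ • ω) μ μ)
    (hu : IsAdmissible vol μ u) : Integrable u (intensity μ) := by
  rcases hu.nonneg_or_integrable with h0 | h
  · have hw := hF.integrable_weight (vol := vol) (μ := μ)
    have h := lintegral_le_of_average vol (m := intensity μ)
      (fun γ => measurePreserving_smul_intensity (hμ γ)) hu.measurable.ennreal_ofReal
      (hF.measurable_weight vol).ennreal_ofReal
      (fun x => (lintegral_ofReal_eq_one (fun γ => h0 _) (hu.integral_smul_eq_one x)).le)
      (fun x => lintegral_ofReal_eq_one (fun γ => IsRoughFundamentalDomain.weight_nonneg _ _ _)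
        (hF.integral_weight_inv x))
    refine (lintegral_ofReal_ne_top_iff_integrable hu.measurable.aestronglyMeasurable
      (.of_forall h0)).1 (h.trans_lt ?_).ne
    exact ((lintegral_ofReal_ne_top_iff_integrable hw.1
      (.of_forall fun x => IsRoughFundamentalDomain.weight_nonneg _ _ _)).2 hw).lt_top
  · exact h

end Admissible

end IDS

namespace IDS

/-! ### The density of states measure -/

lemma measure_ext_of_integral_eq {ν ν' : Measure ℝ} [IsLocallyFiniteMeasure ν]
    [IsLocallyFiniteMeasure ν'] (h : ∀ φ : C_c(ℝ, ℂ), ∫ t, φ t ∂ν = ∫ t, φ t ∂ν') : ν = ν' := by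
  refine Measure.ext_of_integral_eq_on_compactlySupported fun f => ?_
  have := h (f.compLeft ⟨fun t : ℝ => (t : ℂ), Complex.continuous_ofReal⟩)
  simp only [CompactlySupportedContinuousMap.compLeft_apply
    (g := ⟨fun t : ℝ => (t : ℂ), Complex.continuous_ofReal⟩) Complex.ofReal_zero,
    ContinuousMap.coe_mk, integral_complex_ofReal] at this
  exact_mod_cast this

section System

variable {V : Type*} [NormedAddCommGroup V] [InnerProductSpace ℂ V] [CompleteSpace V]

/-- The spectral family `E` of `T` and the measures `ρ_v = ⟨v, E(·) v⟩`. -/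
structure IsSpectralSystem (T : V →L[ℂ] V) (E : Set ℝ → V →L[ℂ] V) (ρ : V → Measure ℝ) :
    Prop where
  isSpectralFamily : IsSpectralFamily T E
  isFiniteMeasure : ∀ v, IsFiniteMeasure (ρ v)
  integral_eq : ∀ v (φ : C_c(ℝ, ℂ)),
    ∫ t, φ t ∂ρ v = inner ℂ v (cfc (fun z : ℂ => φ z.re) T v)
  inner_eq : ∀ v B, MeasurableSet B → inner ℂ v (E B v) = (((ρ v).real B : ℝ) : ℂ)

variable {T : V →L[ℂ] V} {E : Set ℝ → V →L[ℂ] V} {ρ : V → Measure ℝ}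

lemma IsSpectralSystem.measure_univ (h : IsSpectralSystem T E ρ) (v : V) :
    ρ v univ = ENNReal.ofReal (‖v‖ ^ 2) := by
  have := h.isFiniteMeasure v
  have h1 := h.inner_eq v univ MeasurableSet.univ
  rw [h.isSpectralFamily.univ, one_apply_eq_self, inner_self_eq_norm_sq_to_K] at h1
  have h2 : (ρ v).real univ = ‖v‖ ^ 2 :=
    Complex.ofReal_injective (h1.symm.trans (Complex.ofReal_pow _ _).symm)
  rw [← h2, ofReal_measureReal]

/-- For a projection, ⟨v, E(B) v⟩ = ‖E(B) v‖². -/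
lemma IsSpectralSystem.eq_zero_iff (h : IsSpectralSystem T E ρ) (v : V) {B : Set ℝ}
    (hB : MeasurableSet B) : ρ v B = 0 ↔ E B v = 0 := by
  have := h.isFiniteMeasure v
  have h1 := h.inner_eq v B hB
  have hp := h.isSpectralFamily.isStarProjection B hB
  refine ⟨fun h0 => ?_, fun h0 => ?_⟩
  · rw [measureReal_def, h0, ENNReal.toReal_zero, Complex.ofReal_zero] at h1
    rw [← inner_self_eq_zero (𝕜 := ℂ), ← ContinuousLinearMap.adjoint_inner_right,
      hp.isSelfAdjoint.adjoint_eq, ← mul_apply_eq_comp, hp.isIdempotentElem.eq, h1]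
  · rw [h0, inner_zero_right] at h1
    rw [← measureReal_eq_zero_iff]
    exact_mod_cast h1.symm

end System

section DensityOfStates

variable {X K Γ : Type*} [MetricSpace X] [LocallyCompactSpace X] [SecondCountableTopology X]
  [MeasurableSpace X] [BorelSpace X] [TopologicalSpace K] [CompactSpace K] [T2Space K]
  {μ : Measure (Config X K)} [IsProbabilityMeasure μ]
  {Hf : ∀ ω : Config X K, ω.ell2 →L[ℂ] ω.ell2} {φ : C_c(ℝ, ℂ)} {D : Config X K × X → ℂ}
  {H : DirectIntegral μ →L[ℂ] DirectIntegral μ}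

lemma IsDiagonal.integrableOn (hD : IsDiagonal μ Hf φ D) {S : Set (Config X K × X)}
    (hS : fiberMeasure μ S ≠ ∞) : IntegrableOn D S (fiberMeasure μ) := by
  obtain ⟨C, hC⟩ := hD.exists_bound
  exact Measure.integrableOn_of_bounded hS hD.measurable.aestronglyMeasurable
    (ae_restrict_of_ae hC)

/-- At most one point x of X(ω) lies in P, so the fiber of 1_S is δ_x or zero. No matrix elements
off the diagonal occur, and the inner product in the fiber is the sum of 1_S D. -/
lemma inner_indVec_cfc (hdec : Decomposes (fun ω => cfc (fun z : ℂ => φ z.re) (Hf ω))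
    (cfc (fun z : ℂ => φ z.re) H)) (hD : IsDiagonal μ Hf φ D) {S : Set (Config X K × X)}
    (hS : MeasurableSet S) {P : Set X} (hP : MeasurableSet P) (hPs : IsSmall P)
    (hSP : S ⊆ Prod.snd ⁻¹' P) :
    inner ℂ (indVec μ S) (cfc (fun z : ℂ => φ z.re) H (indVec μ S)) =
      ∫ p in S, D p ∂fiberMeasure μ := by
  have hi : Integrable (S.indicator D) (fiberMeasure μ) :=
    (hD.integrableOn (fiberMeasure_ne_top hP hPs hSP)).integrable_indicator hS
  rw [inner_eq_integral, ← integral_indicator hS, integral_fiberMeasure hi]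
  refine integral_congr_ae ?_
  filter_upwards [hdec (indVec μ S), fiber_indVec hS hP hPs hSP, hD.ae_eq,
    ae_integrable_of_integrable hi] with ω h1 h2 h3 h4
  rw [h1]
  have hsum := ω.hasSum_integral h4
  by_cases hex : ∃ x : ω.carrier, (x : X) ∈ P
  · obtain ⟨x, hx⟩ := hex
    have hsingle : HasSum (fun y : ω.carrier => S.indicator D (ω, (y : X)))
        (S.indicator D (ω, (x : X))) :=
      hasSum_single x fun y hy => indicator_of_notMem
        (fun hyS => hy (Subtype.ext (hPs.eq y.2 x.2 (hSP hyS) hx))) D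
    rw [hsum.unique hsingle, h2.1 x hx, map_smul, inner_smul_left, inner_smul_right, ω.inner_basis,
      ← ω.entry_eq_basis, ← h3 x]
    by_cases hxS : (ω, (x : X)) ∈ S
    · simp [hxS]
    · simp [hxS]
  · have hno : ∀ x ∈ ω.carrier, x ∉ P := fun x hx hxP => hex ⟨⟨x, hx⟩, hxP⟩
    rw [h2.2 hno, inner_zero_left]
    have hzero : HasSum (fun _ : ω.carrier => (0 : ℂ)) 0 := hasSum_zero
    refine hzero.unique ?_
    convert hsum using 2 with x
    exact (indicator_of_notMem (fun hxS => hno x x.2 (hSP hxS)) D).symm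

/-- The sum of the spectral measures of the indicator functions of the parts of `Λ`, for a
partition into small sets. -/
def localMeasure (ρ : DirectIntegral μ → Measure ℝ) (n : X → ℕ) (Λ : Set X) : Measure ℝ :=
  Measure.sum fun i => ρ (indVec μ (Prod.snd ⁻¹' (Λ ∩ n ⁻¹' {i})))

variable {E : Set ℝ → DirectIntegral μ →L[ℂ] DirectIntegral μ} {ρ : DirectIntegral μ → Measure ℝ}
  {n : X → ℕ} {Λ : Set X}

lemma IsSpectralSystem.measure_univ_indVec (h : IsSpectralSystem H E ρ)
    {S : Set (Config X K × X)} (hS : MeasurableSet S) (hfin : fiberMeasure μ S ≠ ∞) :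
    ρ (indVec μ S) univ = fiberMeasure μ S := by
  rw [h.measure_univ, indVec_eq hS hfin, norm_indicatorConstLp two_ne_zero ENNReal.ofNat_ne_top,
    norm_one, one_mul, ← Real.rpow_natCast, ← Real.rpow_mul measureReal_nonneg]
  norm_num
  exact ofReal_measureReal hfin

lemma iUnion_inter_index (n : X → ℕ) (Λ : Set X) : ⋃ i, Λ ∩ n ⁻¹' {i} = Λ := by
  rw [← inter_iUnion, ← preimage_iUnion, iUnion_of_singleton, preimage_univ, inter_univ]

lemma pairwise_disjoint_index (n : X → ℕ) (Λ : Set X) :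
    Pairwise (Function.onFun Disjoint fun i => Λ ∩ n ⁻¹' {i}) := fun _ _ hij =>
  ((disjoint_singleton.2 hij).preimage n).mono inter_subset_right inter_subset_right

section Index

variable (hρ : IsSpectralSystem H E ρ) (hn : Measurable n) (hs : ∀ i, IsSmall (n ⁻¹' {i}))
  (hΛ : MeasurableSet Λ)
include hρ hn hs hΛ

lemma localMeasure_univ : localMeasure ρ n Λ univ = intensity μ Λ := by
  have hm : ∀ i, MeasurableSet (Λ ∩ n ⁻¹' {i}) :=
    fun i => hΛ.inter (hn (measurableSet_singleton i))
  rw [localMeasure, Measure.sum_apply _ MeasurableSet.univ]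
  conv_rhs => rw [← iUnion_inter_index n Λ, measure_iUnion (pairwise_disjoint_index n Λ) hm]
  refine tsum_congr fun i => ?_
  rw [hρ.measure_univ_indVec (measurable_snd (hm i)) (fiberMeasure_ne_top (hm i)
    ((hs i).mono inter_subset_right) Subset.rfl), ← map_snd_fiberMeasure,
    Measure.map_apply measurable_snd (hm i)]

lemma isFiniteMeasure_localMeasure (hfin : intensity μ Λ ≠ ∞) :
    IsFiniteMeasure (localMeasure ρ n Λ) :=
  ⟨by rw [localMeasure_univ hρ hn hs hΛ]; exact hfin.lt_top⟩

/-- The link between spectral measures and traces. The right side does not involve the partition, is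
additive in Λ, and inherits the invariance of D. -/
lemma integral_localMeasure (hfin : intensity μ Λ ≠ ∞)
    (hdec : Decomposes (fun ω => cfc (fun z : ℂ => φ z.re) (Hf ω)) (cfc (fun z : ℂ => φ z.re) H))
    (hD : IsDiagonal μ Hf φ D) :
    ∫ t, φ t ∂localMeasure ρ n Λ = ∫ p in Prod.snd ⁻¹' Λ, D p ∂fiberMeasure μ := by
  have hm : ∀ i, MeasurableSet (Λ ∩ n ⁻¹' {i}) :=
    fun i => hΛ.inter (hn (measurableSet_singleton i))
  have := isFiniteMeasure_localMeasure hρ hn hs hΛ hfin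
  have h1 := hasSum_integral_measure
    (φ.integrable (μ := localMeasure ρ n Λ))
  have hU : (⋃ i, (Prod.snd : Config X K × X → X) ⁻¹' (Λ ∩ n ⁻¹' {i})) = Prod.snd ⁻¹' Λ := by
    rw [← preimage_iUnion, iUnion_inter_index]
  have hfin' : fiberMeasure μ (Prod.snd ⁻¹' Λ) ≠ ∞ := by
    rwa [← Measure.map_apply measurable_snd hΛ, map_snd_fiberMeasure]
  have h2 := hasSum_integral_iUnion (f := D) (μ := fiberMeasure μ)
    (fun i => measurable_snd (hm i))
    (fun i j hij => (pairwise_disjoint_index n Λ hij).preimage Prod.snd)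
    (by rw [hU]; exact hD.integrableOn hfin')
  rw [hU] at h2
  refine h1.unique ?_
  convert h2 using 2 with i
  rw [hρ.integral_eq, inner_indVec_cfc hdec hD (measurable_snd (hm i)) (hm i)
    ((hs i).mono inter_subset_right) Subset.rfl]

/-- Let P be the piece over Λ ∩ n⁻¹{i}. As ∫_S D is additive in S, the spectral measures of 1_S and
of 1_{P \ S} add up to that of 1_P. Hence that of 1_S is dominated by it and vanishes on B. -/
lemma apply_indVec_eq_zero
    (hdec : ∀ φ : C_c(ℝ, ℂ), Decomposes (fun ω => cfc (fun z : ℂ => φ z.re) (Hf ω))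
      (cfc (fun z : ℂ => φ z.re) H))
    (hD : ∀ φ : C_c(ℝ, ℂ), ∃ D, IsDiagonal μ Hf φ D) {B : Set ℝ} (hB : MeasurableSet B)
    (h0 : localMeasure ρ n Λ B = 0) {i : ℕ} {S : Set (Config X K × X)} (hS : MeasurableSet S)
    (hSP : S ⊆ Prod.snd ⁻¹' (Λ ∩ n ⁻¹' {i})) : E B (indVec μ S) = 0 := by
  have hP : MeasurableSet (Λ ∩ n ⁻¹' {i}) := hΛ.inter (hn (measurableSet_singleton i))
  have hPs : IsSmall (Λ ∩ n ⁻¹' {i}) := (hs i).mono inter_subset_right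
  rw [localMeasure, Measure.sum_apply _ hB, ENNReal.tsum_eq_zero] at h0
  rw [← hρ.eq_zero_iff _ hB]
  have := hρ.isFiniteMeasure
  have hadd : ρ (indVec μ S) + ρ (indVec μ (Prod.snd ⁻¹' (Λ ∩ n ⁻¹' {i}) \ S)) =
      ρ (indVec μ (Prod.snd ⁻¹' (Λ ∩ n ⁻¹' {i}))) := by
    refine measure_ext_of_integral_eq fun φ => ?_
    obtain ⟨D, hDφ⟩ := hD φ
    rw [integral_add_measure
      φ.integrable φ.integrable,
      hρ.integral_eq, hρ.integral_eq, hρ.integral_eq,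
      inner_indVec_cfc (hdec φ) hDφ hS hP hPs hSP,
      inner_indVec_cfc (hdec φ) hDφ ((measurable_snd hP).diff hS) hP hPs sdiff_subset,
      inner_indVec_cfc (hdec φ) hDφ (measurable_snd hP) hP hPs Subset.rfl]
    have hint := hDφ.integrableOn (fiberMeasure_ne_top (μ := μ) hP hPs Subset.rfl)
    rw [← setIntegral_union disjoint_sdiff_right ((measurable_snd hP).diff hS)
      (hint.mono_set hSP) (hint.mono_set sdiff_subset), union_sdiff_cancel hSP]
  have := congrArg (fun m : Measure ℝ => m B) hadd
  simp only [Measure.add_apply] at this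
  rw [h0 i] at this
  exact (add_eq_zero.1 this).1

/-- The integral of E(B) f over S is ⟨1_S, E(B) f⟩ = ⟨E(B) 1_S, f⟩ = 0 for all measurable S inside a
piece of Λ. -/
lemma ae_restrict_eq_zero
    (hdec : ∀ φ : C_c(ℝ, ℂ), Decomposes (fun ω => cfc (fun z : ℂ => φ z.re) (Hf ω))
      (cfc (fun z : ℂ => φ z.re) H))
    (hD : ∀ φ : C_c(ℝ, ℂ), ∃ D, IsDiagonal μ Hf φ D) {B : Set ℝ} (hB : MeasurableSet B)
    (h0 : localMeasure ρ n Λ B = 0) (f : DirectIntegral μ) :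
    ∀ᵐ p ∂(fiberMeasure μ).restrict (Prod.snd ⁻¹' Λ), E B f p = 0 := by
  have hm : ∀ i, MeasurableSet (Λ ∩ n ⁻¹' {i}) :=
    fun i => hΛ.inter (hn (measurableSet_singleton i))
  have hU : (⋃ i, (Prod.snd : Config X K × X → X) ⁻¹' (Λ ∩ n ⁻¹' {i})) = Prod.snd ⁻¹' Λ := by
    rw [← preimage_iUnion, iUnion_inter_index]
  rw [← hU, ae_restrict_iUnion_iff]
  intro i
  have hPs : IsSmall (Λ ∩ n ⁻¹' {i}) := (hs i).mono inter_subset_right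
  have hfin : fiberMeasure μ (Prod.snd ⁻¹' (Λ ∩ n ⁻¹' {i})) ≠ ∞ :=
    fiberMeasure_ne_top (hm i) hPs Subset.rfl
  have : IsFiniteMeasure ((fiberMeasure μ).restrict (Prod.snd ⁻¹' (Λ ∩ n ⁻¹' {i}))) :=
    ⟨by rw [Measure.restrict_apply_univ]; exact hfin.lt_top⟩
  -- Restricting twice lets the criterion run over a finite measure, for which square integrable
  -- functions are integrable.
  rw [← Measure.restrict_restrict_of_subset Subset.rfl]
  refine ae_eq_zero_restrict_of_forall_setIntegral_eq_zero (fun S hS _ => ?_)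
    (fun S hS _ => ?_) (measurable_snd (hm i))
    (measure_ne_top _ _)
  · exact (((Lp.memLp (E B f)).restrict _).integrable one_le_two).integrableOn
  · rw [Measure.restrict_restrict hS]
    have hSm := hS.inter (measurable_snd (hm i) :
      MeasurableSet ((Prod.snd : Config X K × X → X) ⁻¹' (Λ ∩ n ⁻¹' {i})))
    have hSf : fiberMeasure μ (S ∩ Prod.snd ⁻¹' (Λ ∩ n ⁻¹' {i})) ≠ ∞ :=
      fiberMeasure_ne_top (hm i) hPs inter_subset_right
    rw [← L2.inner_indicatorConstLp_one (𝕜 := ℂ) hSm hSf, ← indVec_eq hSm hSf,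
      ← ContinuousLinearMap.adjoint_inner_left,
      (hρ.isSpectralFamily.isStarProjection B hB).isSelfAdjoint.adjoint_eq,
      apply_indVec_eq_zero hρ hn hs hΛ hdec hD hB h0 hSm inter_subset_right, inner_zero_left]

end Index

end DensityOfStates

end IDS

namespace IDS

/-! ### Invariance of the local spectral measures, their null sets, and the trace formula -/

section Main

variable {X K Γ : Type*} [MetricSpace X] [LocallyCompactSpace X] [SecondCountableTopology X]
  [MeasurableSpace X] [BorelSpace X] [TopologicalSpace K] [CompactSpace K] [T2Space K]
  [Group Γ] [MulAction Γ X] [IsIsometricSMul Γ X]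
  {μ : Measure (Config X K)} [IsProbabilityMeasure μ]
  {Hf : ∀ ω : Config X K, ω.ell2 →L[ℂ] ω.ell2}
  {H : DirectIntegral μ →L[ℂ] DirectIntegral μ}
  {E : Set ℝ → DirectIntegral μ →L[ℂ] DirectIntegral μ} {ρ : DirectIntegral μ → Measure ℝ}
  {n : X → ℕ} {Λ : Set X}

/-- Both measures are finite, and both integrate φ to the same integral of D, since D and the
measure on pairs are invariant. -/
lemma localMeasure_preimage_smul [μ.Regular] {ι : ℂ → K} {s : Γ → X → Circle}
    (hH : ConditionA ι μ s Hf H)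
    (hμ : ∀ γ : Γ, MeasurePreserving (fun ω : Config X K => γ • ω) μ μ)
    (hρ : IsSpectralSystem H E ρ) (hn : Measurable n) (hs : ∀ i, IsSmall (n ⁻¹' {i}))
    (hΛ : MeasurableSet Λ) (hfin : intensity μ Λ ≠ ∞) (γ : Γ) :
    localMeasure ρ n ((fun x => γ • x) ⁻¹' Λ) = localMeasure ρ n Λ := by
  have hm := measurePreserving_smul_intensity (hμ γ)
  have hfin' : intensity μ ((fun x => γ • x) ⁻¹' Λ) ≠ ∞ := by
    rwa [hm.measure_preimage hΛ.nullMeasurableSet]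
  have := isFiniteMeasure_localMeasure hρ hn hs hΛ hfin
  have := isFiniteMeasure_localMeasure hρ hn hs (hm.measurable hΛ) hfin'
  refine measure_ext_of_integral_eq fun φ => ?_
  obtain ⟨D, hD⟩ := hH.exists_isDiagonal φ
  rw [integral_localMeasure hρ hn hs (hm.measurable hΛ) hfin' (hH.decomposes_cfc φ) hD,
    integral_localMeasure hρ hn hs hΛ hfin (hH.decomposes_cfc φ) hD]
  have hp := measurePreserving_pairSMul (hμ γ)
  conv_rhs => rw [← hp.map_eq]
  rw [setIntegral_map (measurable_snd hΛ) hD.measurable.aestronglyMeasurable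
    hp.measurable.aemeasurable]
  refine integral_congr_ae (ae_restrict_of_ae ?_)
  filter_upwards [hH.ae_pairSMul hμ hD γ] with p hp using hp.symm

variable [MetricSpace Γ] [IsTopologicalGroup Γ] [ProperSpace Γ] [IsIsometricSMul Γ Γ]
  [MeasurableSpace Γ] [BorelSpace Γ] [ContinuousSMul Γ X] {F' : Set X}

/-- Countably many translates of `B F'` cover, for the unit ball `B` of the group. -/
lemma IsRoughFundamentalDomain.exists_countable_cover (hF : IsRoughFundamentalDomain Γ F') :
    ∃ γ : ℕ → Γ, ∀ x, ∃ k, γ k • x ∈ Metric.closedBall (1 : Γ) 1 • F' := by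
  refine ⟨TopologicalSpace.denseSeq Γ, fun x => ?_⟩
  have hopen : IsOpen {γ : Γ | γ * hF.index x ∈ Metric.ball (1 : Γ) 1} :=
    Metric.isOpen_ball.preimage (continuous_mul_const _)
  obtain ⟨k, hγ⟩ := (TopologicalSpace.denseRange_denseSeq Γ).exists_mem_open hopen
    ⟨(hF.index x)⁻¹, by
      change (hF.index x)⁻¹ * hF.index x ∈ Metric.ball (1 : Γ) 1
      rw [inv_mul_cancel]
      exact Metric.mem_ball_self one_pos⟩
  refine ⟨k, ?_⟩
  rw [← hF.preimage_index, mem_preimage, hF.index_smul]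
  exact Metric.ball_subset_closedBall hγ

/-- A Borel set that is null for the spectral measures of `B F'` has spectral projection zero. -/
lemma spectral_eq_zero_iff [μ.Regular] {ι : ℂ → K} {s : Γ → X → Circle}
    (hF : IsRoughFundamentalDomain Γ F') (hH : ConditionA ι μ s Hf H)
    (hμ : ∀ γ : Γ, MeasurePreserving (fun ω : Config X K => γ • ω) μ μ)
    (hρ : IsSpectralSystem H E ρ) (hn : Measurable n) (hs : ∀ i, IsSmall (n ⁻¹' {i}))
    {B : Set ℝ} (hB : MeasurableSet B) :
    localMeasure ρ n (Metric.closedBall (1 : Γ) 1 • F') B = 0 ↔ E B = 0 := by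
  have hΛ : MeasurableSet (Metric.closedBall (1 : Γ) 1 • F') :=
    hF.measurableSet_smul measurableSet_closedBall
  have hfin : intensity μ (Metric.closedBall (1 : Γ) 1 • F') ≠ ∞ :=
    (hF.measure_smul_lt_top _ (isCompact_closedBall _ _)).ne
  constructor
  · intro h0
    obtain ⟨γ, hγ⟩ := hF.exists_countable_cover
    ext1 f
    rw [_root_.zero_apply]
    refine Lp.eq_zero_iff_ae_eq_zero.2 ?_
    have hcover : (⋃ k, (Prod.snd : Config X K × X → X) ⁻¹'
        ((fun x => γ k • x) ⁻¹' (Metric.closedBall (1 : Γ) 1 • F'))) = univ :=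
      eq_univ_of_forall fun p => mem_iUnion.2 (hγ p.2)
    -- By invariance B is null for the local measure of each translate, so E(B) f vanishes over each
    -- of countably many sets that cover X.
    have hall : ∀ᵐ p ∂(fiberMeasure μ).restrict (⋃ k, (Prod.snd : Config X K × X → X) ⁻¹'
        ((fun x => γ k • x) ⁻¹' (Metric.closedBall (1 : Γ) 1 • F'))), E B f p = 0 :=
      (ae_restrict_iUnion_iff _ _).2 fun k =>
        ae_restrict_eq_zero hρ hn hs (measurable_smul_const (γ k) hΛ) hH.decomposes_cfc
          hH.exists_isDiagonal hB
          (by rwa [localMeasure_preimage_smul hH hμ hρ hn hs hΛ hfin]) f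
    rwa [hcover, Measure.restrict_univ] at hall
  · intro h0
    rw [localMeasure, Measure.sum_apply _ hB, ENNReal.tsum_eq_zero]
    intro i
    rw [hρ.eq_zero_iff _ hB, h0, _root_.zero_apply]

variable (vol : Measure Γ) [vol.IsHaarMeasure] [vol.IsMulRightInvariant]

/-- The trace with an admissible weight. -/
lemma integral_traceFun_eq [μ.Regular] {ι : ℂ → K} {s : Γ → X → Circle}
    (hF : IsRoughFundamentalDomain Γ F') (hH : ConditionA ι μ s Hf H)
    (hμ : ∀ γ : Γ, MeasurePreserving (fun ω : Config X K => γ • ω) μ μ)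
    (hρ : IsSpectralSystem H E ρ) (hn : Measurable n) (hs : ∀ i, IsSmall (n ⁻¹' {i}))
    {u : X → ℝ} (hu : IsAdmissible vol μ u) (φ : C_c(ℝ, ℂ)) :
    ∫ ω, traceFun Hf u φ ω ∂μ = ((vol.real (Metric.closedBall (1 : Γ) 1) : ℝ) : ℂ)⁻¹ *
      ∫ t, φ t ∂localMeasure ρ n (Metric.closedBall (1 : Γ) 1 • F') := by
  have hΛ : MeasurableSet (Metric.closedBall (1 : Γ) 1 • F') :=
    hF.measurableSet_smul measurableSet_closedBall
  have hfin : intensity μ (Metric.closedBall (1 : Γ) 1 • F') ≠ ∞ :=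
    (hF.measure_smul_lt_top _ (isCompact_closedBall _ _)).ne
  obtain ⟨D, hD⟩ := hH.exists_isDiagonal φ
  obtain ⟨C, hC⟩ := hD.exists_bound
  rw [hD.integral_traceFun (hu.integrable hF hμ),
    integral_localMeasure hρ hn hs hΛ hfin (hH.decomposes_cfc φ) hD,
    integral_eq_of_average vol (intensity μ) (measurePreserving_snd μ)
      (fun γ => measurePreserving_pairSMul (hμ γ)) (fun γ p => rfl)
      (fun γ => measurePreserving_smul_intensity (hμ γ)) hD.measurable.aestronglyMeasurable hC
      (hH.ae_pairSMul hμ hD) hu.measurable (hF.measurable_weight vol) (hu.integrable hF hμ)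
      (IsRoughFundamentalDomain.weight_nonneg vol F') hu.integral_smul_eq_one
      hF.integral_weight_inv, ← integral_const_mul, ← integral_indicator (measurable_snd hΛ)]
  refine integral_congr_ae (.of_forall fun p => ?_)
  simp only [IsRoughFundamentalDomain.weight]
  by_cases hp : p.2 ∈ Metric.closedBall (1 : Γ) 1 • F'
  · rw [indicator_of_mem hp, indicator_of_mem (show p ∈ Prod.snd ⁻¹' (Metric.closedBall (1 : Γ) 1 • F') from hp)]
    simp
  · rw [indicator_of_notMem hp, indicator_of_notMem
      (show p ∉ Prod.snd ⁻¹' (Metric.closedBall (1 : Γ) 1 • F') from hp)]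
    simp

end Main

end IDS

end

theorem theorem2p1 {X Γ K : Type*}
    -- the space, the group with its Haar measure, and the action
    [MetricSpace X] [LocallyCompactSpace X] [SecondCountableTopology X]
    [MeasurableSpace X] [BorelSpace X]
    [Group Γ] [MetricSpace Γ] [IsTopologicalGroup Γ] [LocallyCompactSpace Γ]
    [ProperSpace Γ] [IsIsometricSMul Γ Γ] [MeasurableSpace Γ] [BorelSpace Γ]
    (_amenable : IDS.IsAmenable Γ)
    (vol : Measure Γ) [vol.IsHaarMeasure] [vol.IsMulRightInvariant]
    [MulAction Γ X] [ContinuousSMul Γ X] [IsIsometricSMul Γ X]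
    (F' : Set X) (hF' : IDS.IsRoughFundamentalDomain Γ F')
    -- the compactification of the complex numbers
    [TopologicalSpace K] [CompactSpace K] [T2Space K] (ι : ℂ → K) (hι : IsDenseEmbedding ι)
    -- the invariant probability measure
    (μ : Measure (IDS.Config X K)) [IsProbabilityMeasure μ] [μ.Regular]
    (hμ : ∀ γ : Γ, MeasurePreserving (fun ω : IDS.Config X K => γ • ω) μ μ)
    (hΩ : ∃ ω ∈ μ.support, ω.carrier.Nonempty)
    -- the operator
    (s : Γ → X → Circle)
    (Hf : ∀ ω : IDS.Config X K, ω.ell2 →L[ℂ] ω.ell2)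
    (H : IDS.DirectIntegral μ →L[ℂ] IDS.DirectIntegral μ)
    (hH : IDS.ConditionA ι μ s Hf H) :
    -- the density is a well-defined positive number
    (IDS.dens vol F' μ ≠ 0 ∧ IDS.dens vol F' μ ≠ ∞ ∧
      ∀ I : Set Γ, IsCompact I → IDS.intensity μ (I • F') = IDS.dens vol F' μ * vol I) ∧
    ∃ ν : Measure ℝ, IsLocallyFiniteMeasure ν ∧
      -- for every admissible weight, `ν` is the unique measure with the trace formula
      (∀ u : X → ℝ, IDS.IsAdmissible vol μ u →
        (∀ φ : C_c(ℝ, ℂ), Integrable (IDS.traceFun Hf u φ) μ) ∧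
        IDS.TraceFormula vol F' μ Hf u ν ∧
        ∀ ν' : Measure ℝ, IsLocallyFiniteMeasure ν' →
          IDS.TraceFormula vol F' μ Hf u ν' → ν' = ν) ∧
      -- `ν` is a spectral measure for `H`
      (∃ E : Set ℝ → IDS.DirectIntegral μ →L[ℂ] IDS.DirectIntegral μ,
        IDS.IsSpectralFamily H E ∧ ∀ B : Set ℝ, MeasurableSet B → (ν B = 0 ↔ E B = 0)) ∧
      -- `ν` has a distribution function with values in `ℝ`
      (∀ t : ℝ, ν (Set.Iic t) = ENNReal.ofReal (IDS.distributionFunction ν t)) := by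
  have hm := fun γ : Γ => IDS.measurePreserving_smul_intensity (hμ γ)
  have hdens := hF'.density vol (IDS.intensity μ) hm (IDS.intensity_univ_ne_zero μ hΩ)
    (d := IDS.dens vol F' μ) rfl
  refine ⟨hdens, ?_⟩
  obtain ⟨E, ρ, hE, hρf, hρi, hρE⟩ := IDS.exists_isSpectralFamily hH.selfAdjoint
  have hρ : IDS.IsSpectralSystem H E ρ := ⟨hE, hρf, hρi, hρE⟩
  obtain ⟨n, hn, hs⟩ := IDS.exists_index X
  let ν₀ := IDS.localMeasure ρ n (Metric.closedBall (1 : Γ) 1 • F')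
  have hν₀ : IsFiniteMeasure ν₀ := IDS.isFiniteMeasure_localMeasure hρ hn hs
    (hF'.measurableSet_smul measurableSet_closedBall)
    (hF'.measure_smul_lt_top _ (isCompact_closedBall _ _)).ne
  -- One factor is the 1 / dens(m) of the trace formula, the other normalizes the weight on the unit
  -- ball times F'.
  let c := (IDS.dens vol F' μ)⁻¹ * (vol (Metric.closedBall (1 : Γ) 1))⁻¹
  have hc0 : c ≠ 0 := mul_ne_zero (ENNReal.inv_ne_zero.2 hdens.2.1)
    (ENNReal.inv_ne_zero.2 (IDS.measure_unitBall_ne_top vol))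
  have hc : c ≠ ∞ := ENNReal.mul_ne_top (ENNReal.inv_ne_top.2 hdens.1)
    (ENNReal.inv_ne_top.2 (IDS.measure_unitBall_ne_zero vol))
  have hfin : IsFiniteMeasure (c • ν₀) := ν₀.smul_finite hc
  have hformula : ∀ u : X → ℝ, IDS.IsAdmissible vol μ u →
      IDS.TraceFormula vol F' μ Hf u (c • ν₀) := by
    intro u hu φ
    -- By regularity the support has full measure, so the integral over Ω is the integral over all
    -- configurations.
    rw [Measure.restrict_eq_self_of_ae_mem (s := μ.support) Measure.support_mem_ae_of_regular,
      IDS.integral_traceFun_eq vol hF' hH hμ hρ hn hs hu φ, integral_smul_measure, ← mul_assoc,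
      Complex.real_smul]
    congr 1
    simp only [c, ENNReal.toReal_mul, ENNReal.toReal_inv, measureReal_def]
    push_cast
    rfl
  refine ⟨c • ν₀, inferInstance, fun u hu => ⟨fun φ => ?_, hformula u hu, fun ν' hν' h => ?_⟩,
    ⟨E, hE, fun B hB => ?_⟩, fun t => ?_⟩
  · obtain ⟨D, hD⟩ := hH.exists_isDiagonal φ
    exact hD.integrable_traceFun (hu.integrable hF' hμ)
  · exact IDS.measure_ext_of_integral_eq fun φ => (h φ).trans (hformula u hu φ).symm
  · rw [Measure.smul_apply, smul_eq_mul, mul_eq_zero, or_iff_right hc0,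
      IDS.spectral_eq_zero_iff hF' hH hμ hρ hn hs hB]
  · exact (ofReal_measureReal (measure_ne_top _ _)).symm
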